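/- Let $n_t,n_e,T\ge 1$ be integers with $n_t\le n_e$, let $\sigma_H,\sigma_e>0$, and put $\gamma_e=\sigma_H^2/\sigma_e^2$. For $\sigma>0$ let $\mathcal{CN}(\sigma)$ denote the law on $\mathbb{C}$ with density $\frac{1}{2\pi\sigma^2}e^{-|z|^2/2\sigma^2}$. Let $M_b,M_e$ be invertible complex $Tn_t\times Tn_t$ matrices and let $\Lambda_b$, $\Lambda_e$ be the $\mathbb{Z}[i]$-lattices of all matrices $X\in\mathbb{C}^{n_t\times T}$ with $\mathrm{vec}(X)=M_bu$, respectively $\mathrm{vec}(X)=M_eu$, for some $u\in\mathbb{Z}[i]^{Tn_t}$. Assume $\Lambda_e\subset\Lambda_b$, and write $\mathrm{vol}(\Lambda_b)=|\det(M_bM_b^*)|$. Alice uses coset encoding: she sends a random codeword $X\in\Lambda_b$ (the representative of the coset of $\Lambda_e$ that carries the data plus a random element of $\Lambda_e$), with an arbitrary law on $\Lambda_b$. Eve receives $Z=H_eX+V_e$, where $H_e\in\mathbb{C}^{n_e\times n_t}$ has i.i.d. entries of law $\mathcal{CN}(\sigma_H)$, $V_e\in\mathbb{C}^{n_e\times T}$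 has i.i.d. entries of law $\mathcal{CN}(\sigma_e)$, and $X,H_e,V_e$ are independent. Knowing $H_e$, Eve looks for a point $Y\in\Lambda_b$ that minimizes the Frobenius distance $\|Z-H_eY\|_F$, and her decision is correct if $Y\in X+\Lambda_e$ (if there are several minimizers, it is counted as correct when one of them lies in $X+\Lambda_e$). Let $P_{c,e,H_e}$ be the probability of a correct decision for given $H_e$, and $\bar P_{c,e}=\mathbb{E}_{H_e}[P_{c,e,H_e}]$. Put $$C_{\rm MIMO}=\frac{\mathrm{vol}(\Lambda_b)\,\Gamma_{n_t}(n_e+T)}{\pi^{n_tT}\,\Gamma_{n_t}(n_e)},\qquad \Gamma_p(a)=\pi^{p(p-1)/2}\prod_{k=1}^{p}\Gamma(a-k+1),$$ $$S(\Lambda_e)=\sum_{X\in\Lambda_e\setminus\{0\}}\det(XX^*)^{-n_e-T}\in[0,\infty],$$ where a term with $\det(XX^*)=0$ is $+\infty$; all sums below are sums of nonnegative terms in $[0,\infty]$. Then: 1. $\displaystyle \bar P_{c,e}\le C_{\rm MIMO}\,\gamma_e^{Tn_t}\sum_{X\in\Lambda_e}\det\left(I_{n_t}+\gamma_eXX^*\right)^{-n_e-T}.$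 2. $\displaystyle \bar P_{c,e}\le C_{\rm MIMO}\left[\gamma_e^{Tn_t}+\gamma_e^{-n_en_t}\,S(\Lambda_e)\right].$ 3. The design functional $S(\Lambda_e)$, which the code-design criterion $\min_{\Lambda_e}S(\Lambda_e)$ minimizes, is the high-SNR limit of the normalized contribution of the nonzero points to the sum in 1: $$\lim_{\gamma\to\infty}\gamma^{n_t(n_e+T)}\sum_{X\in\Lambda_e\setminus\{0\}}\det\left(I_{n_t}+\gamma XX^*\right)^{-n_e-T}=S(\Lambda_e)\quad\text{in }[0,\infty].$$ -/

import Mathlib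

open MeasureTheory ProbabilityTheory Filter Topology
open scoped ENNReal Matrix

namespace MIMOWiretap

/-- The centred circular complex Gaussian law with density
`exp (-|z|^2 / (2 σ^2)) / (2 π σ^2)` on `ℂ` (for `σ ≠ 0`): real and imaginary parts are
independent real Gaussians of mean `0` and variance `σ^2`. -/
noncomputable def complexGaussian (σ : ℝ) : Measure ℂ :=
  ((gaussianReal 0 (σ ^ 2).toNNReal).prod (gaussianReal 0 (σ ^ 2).toNNReal)).map
    (fun p : ℝ × ℝ => (⟨p.1, p.2⟩ : ℂ))

/-- The law of an `m × n` matrix with i.i.d. entries of law `complexGaussian σ`. It is used both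
for the Rayleigh fading matrix and for the additive noise. -/
noncomputable def gaussianMatrix (m n : ℕ) (σ : ℝ) : Measure (Fin m → Fin n → ℂ) :=
  Measure.pi (fun _ : Fin m => Measure.pi (fun _ : Fin n => complexGaussian σ))

/-- The `ℤ[i]`-lattice of `nt × T` codewords `X` with `vec X = M u`, `u` a vector of Gaussian
integers; `vec` stacks the columns of a matrix. -/
def codeLattice {nt T : ℕ} (M : Matrix (Fin T × Fin nt) (Fin T × Fin nt) ℂ) :
    AddSubgroup (Matrix (Fin nt) (Fin T) ℂ) where
  carrier := {X | ∃ u : Fin T × Fin nt → GaussianInt, X.vec = M *ᵥ (fun i => (u i : ℂ))}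
  zero_mem' := ⟨0, by
    have h : (fun i : Fin T × Fin nt => (((0 : Fin T × Fin nt → GaussianInt) i : GaussianInt) : ℂ))
        = 0 := by
      funext i
      simp
    rw [h, Matrix.mulVec_zero, Matrix.vec_zero]⟩
  add_mem' := by
    rintro X Y ⟨u, hu⟩ ⟨w, hw⟩
    refine ⟨u + w, ?_⟩
    have h : (fun i => (((u + w) i : GaussianInt) : ℂ))
        = (fun i => (u i : ℂ)) + (fun i => (w i : ℂ)) := by
      funext i
      simp
    rw [h, Matrix.mulVec_add, Matrix.vec_add, hu, hw]
  neg_mem' := by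
    rintro X ⟨u, hu⟩
    refine ⟨-u, ?_⟩
    have h : (fun i => (((-u) i : GaussianInt) : ℂ)) = -(fun i => (u i : ℂ)) := by
      funext i
      simp
    rw [h, Matrix.mulVec_neg, Matrix.vec_neg, hu]

/-- The volume `|det (M M^*)|` of the complex lattice generated by `M`. -/
noncomputable def latticeVol {nt T : ℕ} (M : Matrix (Fin T × Fin nt) (Fin T × Fin nt) ℂ) : ℝ :=
  ‖(M * Mᴴ).det‖

/-- The squared Frobenius norm. -/
noncomputable def frobSq {m n : ℕ} (A : Matrix (Fin m) (Fin n) ℂ) : ℝ :=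
  ∑ i, ∑ j, ‖A i j‖ ^ 2

/-- Coset decoding of the received matrix `Z` through the channel `H` is correct for the sent
codeword `X`: a point `Y` of `Λb` whose image `H Y` is closest to `Z` lies in the coset
`X + Λe`. A tie for the closest point is counted as correct as soon as one of the closest points
lies in the right coset, so this event contains the success event of every tie-breaking rule. -/
def DecodesCorrectly {nt ne T : ℕ} (Λb Λe : AddSubgroup (Matrix (Fin nt) (Fin T) ℂ))
    (H : Matrix (Fin ne) (Fin nt) ℂ) (Z : Matrix (Fin ne) (Fin T) ℂ)
    (X : Matrix (Fin nt) (Fin T) ℂ) : Prop :=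
  ∃ Y ∈ Λb, (∀ Y' ∈ Λb, frobSq (Z - H * Y) ≤ frobSq (Z - H * Y')) ∧ Y - X ∈ Λe

/-- Eve's probability of correct decoding given the channel realization `H`: the codeword
`X ∈ Λb` (a data coset representative plus a random element of `Λe`) is sent with law `law`,
and `Z = H X + V` is received, where `V` is an independent Gaussian noise matrix. -/
noncomputable def correctProbGiven {nt ne T : ℕ} (σe : ℝ)
    (Λb Λe : AddSubgroup (Matrix (Fin nt) (Fin T) ℂ)) (law : PMF Λb)
    (H : Matrix (Fin ne) (Fin nt) ℂ) : ℝ≥0∞ :=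
  ∑' X : Λb, law X * gaussianMatrix ne T σe
    {V | DecodesCorrectly Λb Λe H (H * (X : Matrix (Fin nt) (Fin T) ℂ) + Matrix.of V) X}

/-- Eve's average probability of correct decoding, over an `ne × nt` fading matrix with i.i.d.
entries of law `complexGaussian σH`. -/
noncomputable def avgCorrectProb {nt T : ℕ} (ne : ℕ) (σH σe : ℝ)
    (Λb Λe : AddSubgroup (Matrix (Fin nt) (Fin T) ℂ)) (law : PMF Λb) : ℝ≥0∞ :=
  ∫⁻ H, correctProbGiven σe Λb Λe law (Matrix.of H) ∂(gaussianMatrix ne nt σH)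

/-- The complex multivariate gamma function
`Γ_p(a) = π^(p(p-1)/2) ∏_{k=1}^p Γ(a - k + 1)`. -/
noncomputable def multiGamma (p : ℕ) (a : ℝ) : ℝ :=
  Real.pi ^ (p * (p - 1) / 2) * ∏ k ∈ Finset.Icc 1 p, Real.Gamma (a - k + 1)

/-- `C_MIMO = vol(Λb) Γ_nt(ne + T) / (π^(nt T) Γ_nt(ne))`. -/
noncomputable def cMIMO {nt T : ℕ} (ne : ℕ)
    (Mb : Matrix (Fin T × Fin nt) (Fin T × Fin nt) ℂ) : ℝ :=
  latticeVol Mb * multiGamma nt (ne + T) / (Real.pi ^ (nt * T) * multiGamma nt ne)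

/-- The term `det (I + γ X X^*)^(-ne-T)`; for `γ ≥ 0` the determinant is a real number `≥ 1`. -/
noncomputable def snrTerm {nt T : ℕ} (ne : ℕ) (γ : ℝ) (X : Matrix (Fin nt) (Fin T) ℂ) : ℝ≥0∞ :=
  ENNReal.ofReal (((1 + (γ : ℂ) • (X * Xᴴ)).det.re ^ (ne + T))⁻¹)

/-- The design functional `∑ det (X X^*)^(-ne-T)` over the nonzero `X ∈ Λ`, with `1 / 0 = ∞`. -/
noncomputable def designSum {nt T : ℕ} (ne : ℕ)
    (Λ : AddSubgroup (Matrix (Fin nt) (Fin T) ℂ)) : ℝ≥0∞ :=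
  ∑' X : {X : Matrix (Fin nt) (Fin T) ℂ // X ∈ Λ ∧ X ≠ 0},
    (ENNReal.ofReal ((X.1 * X.1ᴴ).det.re ^ (ne + T)))⁻¹

end MIMOWiretap

/-!
The proof averages a pointwise bound over the fading matrix `H`.

*Fixed channel.* Let `H` have full column rank. The decoder looks at the received signal only
through its least squares coordinates, and subtracting the sent codeword shows that a correct
decision puts the least squares coordinates of the noise into some translate, by a point of `Λe`,
of the Voronoi cell of `Λb` for the norm `‖H X‖` (`decodesCorrectly_subset`). Projecting a Gaussian
gives a Gaussian (`exists_lintegral_gaussWeight_comp_proj`), so the probability is at most the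
integral over the cell of a Gaussian sum over translates of `Λe`. Two facts bound it: the volume of
the cell is at most the covolume of `Λb` (`volume_voronoiCell_le_one`, in coordinates that turn
`Λb` into `ℤ[i]^(T nt)`), and a Gaussian sum over a lattice is maximal when the lattice is not
translated (`tsum_gaussWeight_add_le`). The outcome is a multiple of
`det (H^* H)^T ∑ exp (-‖H X‖² / (2 σe²))`, the sum being over `Λe` (`correctProbGiven_le`).

*Average.* Given `X`, factor `I + γ X X^* = B B^*`. The substitution `H ↦ H B` absorbs the
exponential into the Gaussian density of `H` and produces `det (I + γ X X^*)^(-ne-T)`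
(`lintegral_det_pow_mul_gaussWeight`). What remains is the `T`-th moment of `det (H^* H)`, computed
column by column (`lintegral_det_pow`): given the previous columns, the next one multiplies the Gram
determinant by the squared norm of its projection to their orthogonal complement. This yields the
quotient of multivariate gamma functions in `C_MIMO`.

*Design functional.* With the eigenvalues `λ_i ≥ 0` of `X X^*`, the rescaled term is
`∏ (γ⁻¹ + λ_i)^(-ne-T)`. It is bounded by its limit `∏ λ_i^(-ne-T)` (`pow_mul_snrTerm_le`), which
gives both the second bound and the convergence of the series.
-/

namespace MIMOWiretap

/-! ### Gaussian sums over lattices -/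

/-- The Gaussian weight `exp (-x)` as an extended nonnegative real. -/
noncomputable def gaussWeight (x : ℝ) : ℝ≥0∞ := ENNReal.ofReal (Real.exp (-x))

lemma gaussWeight_add (x y : ℝ) : gaussWeight (x + y) = gaussWeight x * gaussWeight y := by
  rw [gaussWeight, neg_add, Real.exp_add, ENNReal.ofReal_mul (Real.exp_nonneg _)]
  rfl

lemma gaussWeight_anti {x y : ℝ} (h : x ≤ y) : gaussWeight y ≤ gaussWeight x :=
  ENNReal.ofReal_le_ofReal (Real.exp_le_exp.2 (neg_le_neg h))

lemma gaussWeight_ne_top (x : ℝ) : gaussWeight x ≠ ∞ := ENNReal.ofReal_ne_top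

lemma measurable_gaussWeight : Measurable gaussWeight := by
  unfold gaussWeight
  fun_prop

lemma two_mul_mul_le_sq_add_sq (a b : ℝ≥0∞) : 2 * (a * b) ≤ a * a + b * b := by
  wlog h : a ≤ b generalizing a b
  · rw [mul_comm a b, add_comm]
    exact this b a (le_of_not_ge h)
  obtain ⟨d, rfl⟩ := exists_add_of_le h
  calc 2 * (a * (a + d)) ≤ 2 * (a * (a + d)) + d * d := le_self_add
    _ = _ := by ring

/-- Sorting the pairs `(s + d, s - d)` by their common class modulo `2`. -/
lemma tsum_add_mul_sub {Λ : Type*} [AddCommGroup Λ] (h2 : ∀ x : Λ, x + x = 0 → x = 0)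
    (φ ψ : Λ → ℝ≥0∞) :
    ∑' s, ∑' d, φ (s + d) * ψ (s - d) =
      ∑' c : Λ ⧸ (zmultiplesHom (Λ →+ Λ) (AddMonoidHom.id Λ) 2).range,
        (∑' m : {m : Λ // (m : Λ ⧸ (zmultiplesHom (Λ →+ Λ) (AddMonoidHom.id Λ) 2).range) = c},
          φ m) *
        ∑' m : {m : Λ // (m : Λ ⧸ (zmultiplesHom (Λ →+ Λ) (AddMonoidHom.id Λ) 2).range) = c},
          ψ m := by
  set R := (zmultiplesHom (Λ →+ Λ) (AddMonoidHom.id Λ) 2).range with hR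
  have hmem : ∀ x : Λ, x ∈ R ↔ ∃ k, k + k = x := by
    intro x
    simp [hR, AddMonoidHom.mem_range, two_zsmul]
  have key : ∀ m : Λ, ∑' k : Λ, ψ (m - k - k) =
      ∑' n : {n : Λ // (n : Λ ⧸ R) = (m : Λ ⧸ R)}, ψ n := by
    intro m
    have hcl : ∀ k : Λ, ((m - k - k : Λ) : Λ ⧸ R) = (m : Λ ⧸ R) := by
      intro k
      rw [QuotientAddGroup.eq, hmem]
      exact ⟨k, by abel⟩
    let f : Λ → {n : Λ // (n : Λ ⧸ R) = (m : Λ ⧸ R)} := fun k => ⟨m - k - k, hcl k⟩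
    have hf : Function.Bijective f := by
      constructor
      · intro a b hab
        have h1 : m - a - a = m - b - b := congrArg Subtype.val hab
        have h3 : a - b + (a - b) = 0 := by
          have : a - b + (a - b) = (m - b - b) - (m - a - a) := by abel
          rw [this, h1, sub_self]
        exact sub_eq_zero.1 (h2 _ h3)
      · rintro ⟨n, hn⟩
        obtain ⟨k, hk⟩ := (hmem _).1 (QuotientAddGroup.eq.1 hn)
        refine ⟨k, Subtype.ext ?_⟩
        change m - k - k = n
        have : m - k - k = m - (k + k) := by abel
        rw [this, hk]
        abel
    exact (Equiv.ofBijective f hf).tsum_eq (fun n => ψ n.1)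
  calc ∑' s, ∑' d, φ (s + d) * ψ (s - d)
      = ∑' d, ∑' s, φ (s + d) * ψ (s - d) := ENNReal.tsum_comm
    _ = ∑' d, ∑' m, φ m * ψ (m - d - d) := by
        refine tsum_congr fun d => ?_
        rw [← (Equiv.subRight d).tsum_eq]
        refine tsum_congr fun m => ?_
        simp
    _ = ∑' m, ∑' d, φ m * ψ (m - d - d) := ENNReal.tsum_comm
    _ = ∑' m, φ m * ∑' n : {n : Λ // (n : Λ ⧸ R) = (m : Λ ⧸ R)}, ψ n := by
        refine tsum_congr fun m => ?_
        rw [ENNReal.tsum_mul_left, key]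
    _ = ∑' p : (Σ c : Λ ⧸ R, {m : Λ // (m : Λ ⧸ R) = c}),
          φ p.2.1 * ∑' n : {n : Λ // (n : Λ ⧸ R) = (p.2.1 : Λ ⧸ R)}, ψ n :=
        ((Equiv.sigmaFiberEquiv (fun m : Λ => (m : Λ ⧸ R))).tsum_eq
          (fun m : Λ => φ m * ∑' n : {n : Λ // (n : Λ ⧸ R) = (m : Λ ⧸ R)}, ψ n)).symm
    _ = _ := by
        rw [ENNReal.tsum_sigma']
        refine tsum_congr fun c => ?_
        rw [← ENNReal.tsum_mul_right]
        refine tsum_congr fun m => ?_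
        obtain ⟨m, rfl⟩ := m
        rfl

/-- A Gaussian sum over a lattice is largest when the lattice is not translated. This replaces
Poisson summation by the inequality `2 F(u)² ≤ F(2u) F(0) + F(0)²`, which comes from the
parallelogram law and sorting pairs of lattice points by their class modulo `2`; applied to
the supremum of the bounded function `F` it gives `sup F ≤ F(0)`. -/
theorem tsum_gaussWeight_add_le {E : Type*} [AddCommGroup E] (Λ : AddSubgroup E)
    (h2 : ∀ x : E, x + x = 0 → x = 0) (q : E → ℝ)
    (hq : ∀ x y, q (x + y) + q (x - y) = 2 * q x + 2 * q y)
    (hb : ∃ M : ℝ≥0∞, M ≠ ∞ ∧ ∀ u, ∑' l : Λ, gaussWeight (q (u + l)) ≤ M) (u : E) :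
    ∑' l : Λ, gaussWeight (q (u + l)) ≤ ∑' l : Λ, gaussWeight (q l) := by
  set F : E → ℝ≥0∞ := fun u => ∑' l : Λ, gaussWeight (q (u + l)) with hF
  have hF0 : ∑' l : Λ, gaussWeight (q l) = F 0 := by simp [hF]
  have hΛ : ∀ x : Λ, x + x = 0 → x = 0 := fun x hx =>
    Subtype.ext (h2 x.1 (by simpa using congrArg Subtype.val hx))
  have sq : ∀ (f : Λ → ℝ≥0∞) (g : Λ → ℝ≥0∞),
      (∑' a, f a) * ∑' b, g b = ∑' a, ∑' b, f a * g b := by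
    intro f g
    rw [← ENNReal.tsum_mul_right]
    exact tsum_congr fun a => ENNReal.tsum_mul_left.symm
  have prod : ∀ v w : E, F v * F w = ∑' s : Λ, ∑' d : Λ,
      gaussWeight (q (v + w + ((s + d : Λ) : E)) / 2) *
        gaussWeight (q (v - w + ((s - d : Λ) : E)) / 2) := by
    intro v w
    rw [hF, sq]
    refine tsum_congr fun a => tsum_congr fun b => ?_
    rw [← gaussWeight_add, ← gaussWeight_add]
    have := hq (v + a) (w + b)
    have e1 : v + w + ((a + b : Λ) : E) = v + a + (w + b) := by push_cast; abel
    have e2 : v - w + ((a - b : Λ) : E) = v + a - (w + b) := by push_cast; abel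
    rw [e1, e2]
    congr 1
    linarith
  have diag : ∀ v : E, F v * F 0 = ∑' s : Λ, ∑' d : Λ,
      gaussWeight (q (v + ((s + d : Λ) : E)) / 2) *
        gaussWeight (q (v + ((s - d : Λ) : E)) / 2) := by
    intro v
    simpa using prod v 0
  have main : ∀ v : E, 2 * (F v * F v) ≤ F (v + v) * F 0 + F 0 * F 0 := by
    intro v
    have h1 := prod v v
    rw [diag (v + v), diag 0, h1]
    have hz : v - v = 0 := sub_self v
    rw [hz]
    have t1 := tsum_add_mul_sub hΛ (fun l : Λ => gaussWeight (q (v + v + (l : E)) / 2))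
      (fun l : Λ => gaussWeight (q (0 + (l : E)) / 2))
    have t2 := tsum_add_mul_sub hΛ (fun l : Λ => gaussWeight (q (v + v + (l : E)) / 2))
      (fun l : Λ => gaussWeight (q (v + v + (l : E)) / 2))
    have t3 := tsum_add_mul_sub hΛ (fun l : Λ => gaussWeight (q (0 + (l : E)) / 2))
      (fun l : Λ => gaussWeight (q (0 + (l : E)) / 2))
    rw [t1, t2, t3, ← ENNReal.tsum_mul_left, ← ENNReal.tsum_add]
    exact ENNReal.tsum_le_tsum fun c => two_mul_mul_le_sq_add_sq _ _
  obtain ⟨M, hM, hle⟩ := hb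
  set S := ⨆ v, F v with hS
  have hSle : S ≤ M := iSup_le hle
  have hStop : S ≠ ∞ := ne_top_of_le_ne_top hM hSle
  have h0 : F 0 ≤ S := le_iSup F 0
  have hsq : ∀ v, F v * F v ≤ S * F 0 := by
    intro v
    have h1 : 2 * (F v * F v) ≤ 2 * (S * F 0) := by
      refine (main v).trans ?_
      rw [two_mul]
      gcongr
      exact le_iSup F _
    exact (ENNReal.mul_le_mul_iff_right (by simp) (by simp)).1 h1
  rw [hF0]
  refine (le_iSup F u).trans ?_
  by_cases hS0 : S = 0
  · rw [← hS, hS0]; exact zero_le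
  have : S * S ≤ S * F 0 := by
    have h3 : S * S = ⨆ v, F v * S := by rw [hS, ENNReal.iSup_mul]
    rw [h3]
    refine iSup_le fun v => ?_
    rw [hS, ENNReal.mul_iSup]
    refine iSup_le fun w => ?_
    rcases le_total (F v) (F w) with h | h
    · exact (mul_le_mul_left h _).trans (hsq w)
    · exact (mul_le_mul_right h _).trans (hsq v)
  exact (ENNReal.mul_le_mul_iff_right hS0 hStop).1 this

/-! ### Voronoi cells of the Gaussian integers -/

section Voronoi

open scoped Pointwise

/-- The lattice `ℤ[i]^ι` of Gaussian integer vectors. -/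
noncomputable def gaussIntLattice (ι : Type*) : AddSubgroup (ι → ℂ) :=
  (GaussianInt.toComplex.toAddMonoidHom.compLeft ι).range

lemma mem_gaussIntLattice {ι : Type*} {x : ι → ℂ} :
    x ∈ gaussIntLattice ι ↔ ∃ u : ι → GaussianInt, x = fun i => (u i : ℂ) := by
  simp only [gaussIntLattice, AddMonoidHom.mem_range]
  exact ⟨fun ⟨u, hu⟩ => ⟨u, hu.symm⟩, fun ⟨u, hu⟩ => ⟨u, hu.symm⟩⟩

instance countable_gaussIntLattice (ι : Type*) [Finite ι] : Countable (gaussIntLattice ι) := by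
  have h1 : Countable GaussianInt :=
    Function.Injective.countable (f := fun z : GaussianInt => (z.re, z.im)) (by
      rintro ⟨a, b⟩ ⟨c, d⟩ h
      simp only [Prod.mk.injEq] at h
      obtain ⟨rfl, rfl⟩ := h
      rfl)
  exact (Set.countable_range (GaussianInt.toComplex.toAddMonoidHom.compLeft ι)).to_subtype

/-- The half-open unit cube of `ℂ^ι`, a fundamental domain of `ℤ[i]^ι`. -/
def unitCube (ι : Type*) : Set (ι → ℂ) :=
  Set.univ.pi fun _ => Set.Ico 0 1 ×ℂ Set.Ico 0 1

variable {ι : Type*} [Fintype ι]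

lemma measurableSet_Ico_reProdIm :
    MeasurableSet (Set.Ico (0 : ℝ) 1 ×ℂ Set.Ico (0 : ℝ) 1) :=
  (Complex.measurable_re measurableSet_Ico).inter (Complex.measurable_im measurableSet_Ico)

lemma measurableSet_unitCube : MeasurableSet (unitCube ι) :=
  MeasurableSet.univ_pi fun _ => measurableSet_Ico_reProdIm

lemma volume_unitCube : volume (unitCube ι) = 1 := by
  rw [unitCube, volume_pi_pi]
  refine Finset.prod_eq_one fun i _ => ?_
  rw [← Complex.volume_preserving_equiv_real_prod.symm.measure_preimage
    measurableSet_Ico_reProdIm.nullMeasurableSet]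
  have : (Complex.measurableEquivRealProd.symm ⁻¹' (Set.Ico (0 : ℝ) 1 ×ℂ Set.Ico (0 : ℝ) 1)) =
      Set.Ico (0 : ℝ) 1 ×ˢ Set.Ico (0 : ℝ) 1 := by
    ext ⟨a, b⟩
    simp [Complex.mem_reProdIm, Complex.measurableEquivRealProd_symm_apply]
  rw [this, Measure.volume_eq_prod, Measure.prod_prod]
  simp

lemma isAddFundamentalDomain_unitCube :
    IsAddFundamentalDomain (gaussIntLattice ι) (unitCube ι) (volume : Measure (ι → ℂ)) := by
  refine IsAddFundamentalDomain.mk' measurableSet_unitCube.nullMeasurableSet fun x => ?_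
  let u : ι → GaussianInt := fun i => ⟨-⌊(x i).re⌋, -⌊(x i).im⌋⟩
  have key : ∀ u' : ι → GaussianInt, (fun i => (u' i : ℂ)) + x ∈ unitCube ι ↔ u' = u := by
    intro u'
    simp only [unitCube, Set.mem_univ_pi, Complex.mem_reProdIm, Set.mem_Ico, Pi.add_apply,
      Complex.add_re, Complex.add_im, ← GaussianInt.intCast_re, ← GaussianInt.intCast_im]
    have aux : ∀ (z : ℤ) (y : ℝ), (0 ≤ (z : ℝ) + y ∧ (z : ℝ) + y < 1) ↔ z = -⌊y⌋ := by
      intro z y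
      rw [eq_neg_iff_add_eq_zero, add_comm z, ← Int.floor_add_intCast, Int.floor_eq_zero_iff,
        Set.mem_Ico, add_comm y]
    simp only [aux]
    constructor
    · intro h
      funext i
      exact Zsqrtd.ext (h i).1 (h i).2
    · rintro rfl i
      exact ⟨rfl, rfl⟩
  refine ⟨⟨fun i => (u i : ℂ), mem_gaussIntLattice.2 ⟨u, rfl⟩⟩, (key u).2 rfl, ?_⟩
  rintro ⟨g, hg⟩ hgx
  obtain ⟨u', rfl⟩ := mem_gaussIntLattice.1 hg
  have := (key u').1 hgx
  subst this
  rfl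

variable {W : Type*} [NormedAddCommGroup W] [InnerProductSpace ℂ W]

/-- The closed Voronoi cell of `ℤ[i]^ι` for the metric `‖L (x - y)‖`. -/
def voronoiCell (L : (ι → ℂ) →ₗ[ℂ] W) : Set (ι → ℂ) :=
  {x | ∀ w ∈ gaussIntLattice ι, ‖L x‖ ≤ ‖L x - L w‖}

lemma measurableSet_voronoiCell (L : (ι → ℂ) →ₗ[ℂ] W) : MeasurableSet (voronoiCell L) := by
  have hL : Continuous L := L.continuous_of_finiteDimensional
  refine IsClosed.measurableSet ?_
  simp only [voronoiCell, Set.ofPred_forall]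
  exact isClosed_iInter fun w => isClosed_iInter fun _ =>
    isClosed_le (by fun_prop) (by fun_prop)

/-- Shrinking the cell by a factor `t < 1` makes its lattice translates disjoint. -/
lemma norm_lt_of_mem_smul_voronoiCell {κ : Type*} {L : (κ → ℂ) →ₗ[ℂ] W} (hL : Function.Injective L)
    {t : ℝ} (ht0 : 0 ≤ t) (ht : t < 1) {x w : κ → ℂ} (hx : x ∈ t • voronoiCell L)
    (hw : w ∈ gaussIntLattice κ) (hw0 : w ≠ 0) : ‖L x‖ < ‖L x - L w‖ := by
  obtain ⟨y, hy, rfl⟩ := hx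
  have h1 : ‖L y‖ ^ 2 ≤ ‖L y - L w‖ ^ 2 := by
    have := hy w hw
    gcongr
  have hLw : 0 < ‖L w‖ := norm_pos_iff.2 fun h => hw0 (hL (by simpa using h))
  refine lt_of_pow_lt_pow_left₀ 2 (norm_nonneg _) ?_
  have e : L (t • y) = (t : ℂ) • L y := by
    rw [← map_smul]
    congr 1
  simp only [e]
  rw [norm_sub_sq (𝕜 := ℂ)] at h1 ⊢
  rw [inner_smul_left]
  simp only [Complex.conj_ofReal, RCLike.re_to_complex, Complex.re_ofReal_mul] at h1 ⊢
  nlinarith [sq_pos_of_pos hLw, mul_pos (sub_pos.2 ht) (sq_pos_of_pos hLw)]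

/-- A Voronoi cell of `ℤ[i]^ι` has at most the volume `1` of a fundamental domain. -/
lemma volume_voronoiCell_le_one {L : (ι → ℂ) →ₗ[ℂ] W} (hL : Function.Injective L) :
    volume (voronoiCell L) ≤ 1 := by
  have hlt : ∀ t : ℝ, 0 < t → t < 1 →
      ENNReal.ofReal (t ^ (Module.finrank ℝ (ι → ℂ))) * volume (voronoiCell L) ≤ 1 := by
    intro t ht0 ht
    have h1 := Measure.addHaar_smul (volume : Measure (ι → ℂ)) t (voronoiCell L)
    rw [abs_of_nonneg (by positivity)] at h1
    rw [← h1, ← volume_unitCube (ι := ι)]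
    refine isAddFundamentalDomain_unitCube.measure_le_of_pairwise_disjoint
      ((measurableSet_voronoiCell L).const_smul₀ t).nullMeasurableSet fun g h hgh => ?_
    refine Disjoint.aedisjoint ?_
    rw [Set.disjoint_left]
    rintro x ⟨hxg, -⟩ ⟨hxh, -⟩
    obtain ⟨y, hy, hyx⟩ := hxg
    obtain ⟨z, hz, hzx⟩ := hxh
    have hyx' : (g : ι → ℂ) + y = x := hyx
    have hzx' : (h : ι → ℂ) + z = x := hzx
    have hne : (h : ι → ℂ) - g ≠ 0 := fun hz => hgh (Subtype.ext (sub_eq_zero.1 hz).symm)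
    have a1 := norm_lt_of_mem_smul_voronoiCell hL ht0.le ht hy
      ((gaussIntLattice ι).sub_mem h.2 g.2) hne
    have a2 := norm_lt_of_mem_smul_voronoiCell hL ht0.le ht hz
      ((gaussIntLattice ι).sub_mem g.2 h.2) (by rw [← neg_sub]; exact neg_ne_zero.2 hne)
    have e1 : y - ((h : ι → ℂ) - g) = z := by
      rw [eq_sub_of_add_eq' hyx', eq_sub_of_add_eq' hzx']; abel
    have e2 : z - ((g : ι → ℂ) - h) = y := by rw [← e1]; abel
    rw [← map_sub, e1] at a1
    rw [← map_sub, e2] at a2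
    exact lt_asymm a1 a2
  have hlim : Tendsto (fun t : ℝ => ENNReal.ofReal (t ^ (Module.finrank ℝ (ι → ℂ))) *
      volume (voronoiCell L)) (𝓝[<] 1) (𝓝 (1 * volume (voronoiCell L))) := by
    refine ENNReal.Tendsto.mul_const ?_ (Or.inl one_ne_zero)
    have : Tendsto (fun t : ℝ => ENNReal.ofReal (t ^ (Module.finrank ℝ (ι → ℂ)))) (𝓝 1)
        (𝓝 (ENNReal.ofReal (1 ^ (Module.finrank ℝ (ι → ℂ))))) :=
      (ENNReal.continuous_ofReal.comp (continuous_pow _)).tendsto 1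
    simp only [one_pow, ENNReal.ofReal_one] at this
    exact this.mono_left nhdsWithin_le_nhds
  rw [one_mul] at hlim
  refine le_of_tendsto hlim ?_
  filter_upwards [Ioo_mem_nhdsLT (show (0 : ℝ) < 1 by norm_num)] with t ht
  exact hlt t ht.1 ht.2

/-- Gaussian sums over translates of a sublattice of `ℤ[i]^ι` are uniformly bounded: each term is
dominated by an integral over a cube, and the cubes tile the space. -/
lemma exists_tsum_gaussWeight_le (L : (ι → ℂ) →ₗ[ℂ] W) {c : ℝ} (hc : 0 < c)
    (hfin : ∫⁻ x, gaussWeight (c / 2 * ‖L x‖ ^ 2) ≠ ∞)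
    {Λ : AddSubgroup (ι → ℂ)} (hΛ : Λ ≤ gaussIntLattice ι) :
    ∃ M : ℝ≥0∞, M ≠ ∞ ∧ ∀ u, ∑' l : Λ, gaussWeight (c * ‖L (u + l)‖ ^ 2) ≤ M := by
  have hLc : Continuous L := L.continuous_of_finiteDimensional
  obtain ⟨C, hC⟩ : ∃ C : ℝ, ∀ y ∈ unitCube ι, c * ‖L y‖ ^ 2 ≤ C := by
    have hbd : unitCube ι ⊆ Metric.closedBall 0 2 := by
      intro y hy
      rw [mem_closedBall_zero_iff, pi_norm_le_iff_of_nonneg (by norm_num)]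
      intro i
      have := hy i (Set.mem_univ i)
      simp only [Complex.mem_reProdIm, Set.mem_Ico] at this
      refine (Complex.norm_le_abs_re_add_abs_im _).trans ?_
      rw [abs_of_nonneg this.1.1, abs_of_nonneg this.2.1]
      linarith [this.1.2, this.2.2]
    obtain ⟨C, hC⟩ := (isCompact_closedBall (0 : ι → ℂ) 2).bddAbove_image
      (f := fun y => c * ‖L y‖ ^ 2) (by fun_prop)
    exact ⟨C, fun y hy => hC ⟨y, hbd hy, rfl⟩⟩
  have hmeas : Measurable fun x : ι → ℂ => gaussWeight (c / 2 * ‖L x‖ ^ 2) :=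
    measurable_gaussWeight.comp (Continuous.measurable (by fun_prop))
  refine ⟨gaussWeight (-C) * ∫⁻ x, gaussWeight (c / 2 * ‖L x‖ ^ 2),
    ENNReal.mul_ne_top (gaussWeight_ne_top _) hfin, fun u => ?_⟩
  have term : ∀ l : gaussIntLattice ι, gaussWeight (c * ‖L (u + l)‖ ^ 2) ≤
      gaussWeight (-C) * ∫⁻ y in unitCube ι, gaussWeight (c / 2 * ‖L (u + (l + y))‖ ^ 2) := by
    intro l
    have hm : Measurable fun y : ι → ℂ => gaussWeight (c / 2 * ‖L (u + (l + y))‖ ^ 2) :=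
      measurable_gaussWeight.comp (Continuous.measurable (by fun_prop))
    rw [← lintegral_const_mul _ hm]
    calc gaussWeight (c * ‖L (u + l)‖ ^ 2)
        = ∫⁻ y in unitCube ι, gaussWeight (c * ‖L (u + l)‖ ^ 2) := by
          rw [setLIntegral_const, volume_unitCube, mul_one]
      _ ≤ _ := by
        refine setLIntegral_mono (hm.const_mul _) fun y hy => ?_
        rw [← gaussWeight_add]
        refine gaussWeight_anti ?_
        have h1 := parallelogram_law_with_norm ℂ (L (u + l)) (L y)
        have e : L (u + (l + y)) = L (u + l) + L y := by rw [← map_add, add_assoc]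
        rw [e]
        nlinarith [hC y hy, sq_nonneg ‖L (u + l) - L y‖,
          mul_nonneg hc.le (sq_nonneg ‖L (u + l) - L y‖)]
  calc ∑' l : Λ, gaussWeight (c * ‖L (u + l)‖ ^ 2)
      ≤ ∑' l : gaussIntLattice ι, gaussWeight (c * ‖L (u + l)‖ ^ 2) :=
        ENNReal.tsum_comp_le_tsum_of_injective (AddSubgroup.inclusion_injective hΛ)
          (fun l : gaussIntLattice ι => gaussWeight (c * ‖L (u + l)‖ ^ 2))
    _ ≤ ∑' l : gaussIntLattice ι, gaussWeight (-C) *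
          ∫⁻ y in unitCube ι, gaussWeight (c / 2 * ‖L (u + (l + y))‖ ^ 2) :=
        ENNReal.tsum_le_tsum term
    _ = gaussWeight (-C) * ∫⁻ x, gaussWeight (c / 2 * ‖L (u + x)‖ ^ 2) := by
        rw [ENNReal.tsum_mul_left,
          isAddFundamentalDomain_unitCube.lintegral_eq_tsum''
            (fun x => gaussWeight (c / 2 * ‖L (u + x)‖ ^ 2))]
        rfl
    _ = _ := by
        rw [lintegral_add_left_eq_self (fun x => gaussWeight (c / 2 * ‖L x‖ ^ 2)) u]

/-- The Gaussian mass of the union of the translates of a Voronoi cell of `ℤ[i]^ι` by a sublattice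
`Λ` is at most the (untranslated) Gaussian sum over `Λ`. -/
lemma tsum_lintegral_voronoiCell_le {L : (ι → ℂ) →ₗ[ℂ] W} (hL : Function.Injective L) {c : ℝ}
    (hc : 0 < c) (hfin : ∫⁻ x, gaussWeight (c / 2 * ‖L x‖ ^ 2) ≠ ∞)
    {Λ : AddSubgroup (ι → ℂ)} (hΛ : Λ ≤ gaussIntLattice ι) :
    ∑' l : Λ, ∫⁻ x, gaussWeight (c * ‖L x‖ ^ 2) *
        (voronoiCell L).indicator (fun _ => 1) (x - l) ≤
      ∑' l : Λ, gaussWeight (c * ‖L l‖ ^ 2) := by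
  have hLc : Continuous L := L.continuous_of_finiteDimensional
  have hcount : Countable Λ := (AddSubgroup.inclusion_injective hΛ).countable
  have hm : ∀ l : Λ, Measurable fun x : ι → ℂ => gaussWeight (c * ‖L (x + l)‖ ^ 2) := fun l =>
    measurable_gaussWeight.comp (Continuous.measurable (by fun_prop))
  have hshift : ∀ l : Λ, ∫⁻ x, gaussWeight (c * ‖L x‖ ^ 2) *
        (voronoiCell L).indicator (fun _ => 1) (x - l) =
      ∫⁻ x in voronoiCell L, gaussWeight (c * ‖L (x + l)‖ ^ 2) := by
    intro l
    rw [← lintegral_add_right_eq_self _ (l : ι → ℂ),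
      ← lintegral_indicator (measurableSet_voronoiCell L)]
    refine lintegral_congr fun x => ?_
    by_cases hx : x ∈ voronoiCell L <;> simp [hx]
  simp_rw [hshift]
  rw [← lintegral_tsum fun l => (hm l).aemeasurable]
  calc ∫⁻ x in voronoiCell L, ∑' l : Λ, gaussWeight (c * ‖L (x + l)‖ ^ 2)
      ≤ ∫⁻ x in voronoiCell L, ∑' l : Λ, gaussWeight (c * ‖L l‖ ^ 2) := by
        refine lintegral_mono fun x => ?_
        refine tsum_gaussWeight_add_le Λ (fun y hy => ?_) (fun y => c * ‖L y‖ ^ 2) (fun y z => ?_)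
          (exists_tsum_gaussWeight_le L hc hfin hΛ) x
        · rw [← two_smul ℂ] at hy
          exact (smul_eq_zero.1 hy).resolve_left two_ne_zero
        · have := parallelogram_law_with_norm ℂ (L y) (L z)
          simp only [map_add, map_sub]
          linear_combination c * this
    _ = (∑' l : Λ, gaussWeight (c * ‖L l‖ ^ 2)) * volume (voronoiCell L) := by
        rw [setLIntegral_const]
    _ ≤ _ := mul_le_of_le_one_right' (volume_voronoiCell_le_one hL)

end Voronoi

/-! ### Gaussian integrals -/

section Pi

variable {α : Type*} [MeasurableSpace α] {μ : Measure α} [SigmaFinite μ]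

lemma lintegral_fin_prod {n : ℕ} {f : Fin n → α → ℝ≥0∞} (hf : ∀ i, Measurable (f i)) :
    ∫⁻ x : Fin n → α, ∏ i, f i (x i) ∂(Measure.pi fun _ => μ) = ∏ i, ∫⁻ y, f i y ∂μ := by
  induction n with
  | zero => simp
  | succ n ih =>
    have hm : Measurable fun x : Fin n → α => ∏ i : Fin n, f i.succ (x i) :=
      Finset.measurable_prod _ fun i _ => (hf i.succ).comp (measurable_pi_apply i)
    rw [((measurePreserving_piFinSuccAbove (fun _ : Fin (n + 1) => μ) 0).symm
        (MeasurableEquiv.piFinSuccAbove (fun _ => α) 0)).lintegral_map_equiv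
        (fun x => ∏ i, f i (x i)), Fin.prod_univ_succ, ← ih fun i => hf i.succ, ← lintegral_prod_mul (hf 0).aemeasurable
        hm.aemeasurable]
    refine lintegral_congr fun p => ?_
    simp [Fin.prod_univ_succ, MeasurableEquiv.piFinSuccAbove, Fin.insertNthEquiv]

lemma lintegral_pi_prod {ι : Type*} [Fintype ι] {f : ι → α → ℝ≥0∞} (hf : ∀ i, Measurable (f i)) :
    ∫⁻ x : ι → α, ∏ i, f i (x i) ∂(Measure.pi fun _ => μ) = ∏ i, ∫⁻ y, f i y ∂μ := by
  let e := (Fintype.equivFin ι).symm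
  rw [(measurePreserving_piCongrLeft (fun _ : ι => μ) e).lintegral_map_equiv
      (fun x => ∏ i, f i (x i)), ← e.prod_comp, ← lintegral_fin_prod fun i => hf (e i)]
  refine lintegral_congr fun p => ?_
  rw [← e.prod_comp]
  refine Finset.prod_congr rfl fun i _ => ?_
  congr 1
  exact Equiv.piCongrLeft_apply_apply (fun _ => α) e p i

lemma pi_withDensity {ι : Type*} [Fintype ι] {f : α → ℝ≥0∞} (hf : Measurable f)
    [SigmaFinite (μ.withDensity f)] :
    Measure.pi (fun _ : ι => μ.withDensity f) =
      (Measure.pi fun _ : ι => μ).withDensity fun x => ∏ i, f (x i) := by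
  refine Measure.pi_eq fun s hs => ?_
  rw [withDensity_apply _ (MeasurableSet.univ_pi hs),
    ← lintegral_indicator (MeasurableSet.univ_pi hs)]
  have : ∀ x : ι → α, (Set.univ.pi s).indicator (fun x => ∏ i, f (x i)) x =
      ∏ i, (s i).indicator f (x i) := by
    intro x
    by_cases hx : x ∈ Set.univ.pi s
    · rw [Set.indicator_of_mem hx]
      exact Finset.prod_congr rfl fun i _ => (Set.indicator_of_mem (hx i trivial) _).symm
    · rw [Set.indicator_of_notMem hx]
      simp only [Set.mem_pi, Set.mem_univ, forall_const, not_forall] at hx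
      obtain ⟨i, hi⟩ := hx
      exact (Finset.prod_eq_zero (Finset.mem_univ i) (Set.indicator_of_notMem hi _)).symm
  simp_rw [this]
  rw [lintegral_pi_prod fun i => hf.indicator (hs i)]
  refine Finset.prod_congr rfl fun i _ => ?_
  rw [withDensity_apply _ (hs i), lintegral_indicator (hs i)]

end Pi

lemma gaussWeight_sum {ι : Type*} (s : Finset ι) (f : ι → ℝ) :
    gaussWeight (∑ i ∈ s, f i) = ∏ i ∈ s, gaussWeight (f i) := by
  classical
  induction s using Finset.induction_on with
  | empty => simp [gaussWeight]
  | insert a s ha ih => rw [Finset.sum_insert ha, Finset.prod_insert ha, gaussWeight_add, ih]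

/-- The density of `complexGaussian σ`, in terms of `a = 1 / (2 σ²)`. -/
lemma complexGaussian_eq_withDensity {σ a : ℝ} (hσ : 0 < σ) (ha : a = (2 * σ ^ 2)⁻¹) :
    complexGaussian σ = volume.withDensity fun z =>
      ENNReal.ofReal (a / Real.pi) * gaussWeight (a * ‖z‖ ^ 2) := by
  have hv : (σ ^ 2).toNNReal ≠ 0 := by
    simp only [ne_eq, Real.toNNReal_eq_zero, not_le]; positivity
  have hcoe : ((σ ^ 2).toNNReal : ℝ) = σ ^ 2 := Real.coe_toNNReal _ (by positivity)
  rw [complexGaussian, gaussianReal_of_var_ne_zero _ hv,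
    prod_withDensity (measurable_gaussianPDF _ _) (measurable_gaussianPDF _ _)]
  have hmp := Complex.volume_preserving_equiv_real_prod.symm
  have hfun : (fun p : ℝ × ℝ => (⟨p.1, p.2⟩ : ℂ)) = Complex.measurableEquivRealProd.symm := rfl
  ext s hs
  rw [hfun, Measure.map_apply (MeasurableEquiv.measurable _) hs,
    withDensity_apply _ ((MeasurableEquiv.measurable _) hs), withDensity_apply _ hs,
    ← lintegral_indicator hs, hmp.lintegral_map_equiv (s.indicator _), ← lintegral_indicator
    ((MeasurableEquiv.measurable _) hs)]
  rw [Measure.volume_eq_prod]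
  refine lintegral_congr fun p => ?_
  by_cases hp : Complex.measurableEquivRealProd.symm p ∈ s
  · rw [Set.indicator_of_mem hp, Set.indicator_of_mem (by exact hp)]
    rw [gaussianPDF, gaussianPDF, ← ENNReal.ofReal_mul (gaussianPDFReal_nonneg _ _ _), gaussWeight,
      ← ENNReal.ofReal_mul (by rw [ha]; positivity)]
    congr 1
    simp only [gaussianPDFReal, hcoe, sub_zero]
    have e : ‖Complex.measurableEquivRealProd.symm p‖ ^ 2 = p.1 ^ 2 + p.2 ^ 2 := by
      rw [Complex.sq_norm, Complex.normSq_apply]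
      simp [Complex.measurableEquivRealProd_symm_apply]
      ring
    rw [e, mul_mul_mul_comm, ← Real.exp_add, ← mul_inv, Real.mul_self_sqrt (by positivity), ha]
    congr 1
    · field_simp
    · congr 1
      field_simp
      ring
  · rw [Set.indicator_of_notMem hp, Set.indicator_of_notMem (by exact hp)]

instance isProbabilityMeasure_complexGaussian (σ : ℝ) :
    IsProbabilityMeasure (complexGaussian σ) := by
  have : Measurable fun p : ℝ × ℝ => (⟨p.1, p.2⟩ : ℂ) :=
    Complex.measurableEquivRealProd.symm.measurable
  exact Measure.isProbabilityMeasure_map this.aemeasurable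

lemma measurable_gaussWeight_norm_sq (a : ℝ) : Measurable fun z : ℂ => gaussWeight (a * ‖z‖ ^ 2) :=
  measurable_gaussWeight.comp (by fun_prop)

lemma lintegral_gaussWeight_complex {a : ℝ} (ha : 0 < a) :
    ∫⁻ z : ℂ, gaussWeight (a * ‖z‖ ^ 2) = ENNReal.ofReal (Real.pi / a) := by
  -- the total mass of `complexGaussian σ` with `σ ^ 2 = 1 / (2 a)` is `1`
  set σ := Real.sqrt ((2 * a)⁻¹) with hσ
  have hσ0 : 0 < σ := Real.sqrt_pos.2 (by positivity)
  have h1 : a = (2 * σ ^ 2)⁻¹ := by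
    rw [hσ, Real.sq_sqrt (by positivity)]
    field_simp
  have h2 : complexGaussian σ Set.univ = 1 := measure_univ
  rw [complexGaussian_eq_withDensity hσ0 h1, withDensity_apply _ MeasurableSet.univ,
    Measure.restrict_univ, lintegral_const_mul _ (measurable_gaussWeight_norm_sq a)] at h2
  rw [← one_mul (∫⁻ z : ℂ, gaussWeight (a * ‖z‖ ^ 2)),
    show (1 : ℝ≥0∞) = ENNReal.ofReal (Real.pi / a) * ENNReal.ofReal (a / Real.pi) by
      rw [← ENNReal.ofReal_mul (by positivity)]
      field_simp
      simp, mul_assoc, h2, mul_one]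

lemma lintegral_gaussWeight_pi {ι : Type*} [Fintype ι] {a : ℝ} (ha : 0 < a) :
    ∫⁻ x : ι → ℂ, gaussWeight (a * ∑ i, ‖x i‖ ^ 2) =
      ENNReal.ofReal ((Real.pi / a) ^ Fintype.card ι) := by
  simp_rw [Finset.mul_sum, gaussWeight_sum]
  rw [volume_pi, lintegral_pi_prod fun _ => measurable_gaussWeight_norm_sq a,
    lintegral_gaussWeight_complex ha]
  simp [ENNReal.ofReal_pow (div_nonneg Real.pi_nonneg ha.le)]

lemma gaussianMatrix_eq_withDensity (m n : ℕ) {σ a : ℝ} (hσ : 0 < σ) (ha : a = (2 * σ ^ 2)⁻¹) :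
    gaussianMatrix m n σ = volume.withDensity fun V =>
      ENNReal.ofReal ((a / Real.pi) ^ (m * n)) * gaussWeight (a * frobSq (Matrix.of V)) := by
  have ha0 : 0 ≤ a / Real.pi := by rw [ha]; positivity
  have hm : Measurable fun z : ℂ => ENNReal.ofReal (a / Real.pi) * gaussWeight (a * ‖z‖ ^ 2) :=
    (measurable_gaussWeight_norm_sq a).const_mul _
  have hcg := complexGaussian_eq_withDensity hσ ha
  have i1 : SigmaFinite (volume.withDensity fun z : ℂ =>
      ENNReal.ofReal (a / Real.pi) * gaussWeight (a * ‖z‖ ^ 2)) := by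
    rw [← hcg]; infer_instance
  have hrow : Measure.pi (fun _ : Fin n => complexGaussian σ) =
      volume.withDensity fun x : Fin n → ℂ =>
        ∏ j, (ENNReal.ofReal (a / Real.pi) * gaussWeight (a * ‖x j‖ ^ 2)) := by
    rw [hcg, pi_withDensity hm, volume_pi]
  have i2 : SigmaFinite (volume.withDensity fun x : Fin n → ℂ =>
        ∏ j, (ENNReal.ofReal (a / Real.pi) * gaussWeight (a * ‖x j‖ ^ 2))) := by
    rw [← hrow]; infer_instance
  have hrm : Measurable fun x : Fin n → ℂ =>
      ∏ j, (ENNReal.ofReal (a / Real.pi) * gaussWeight (a * ‖x j‖ ^ 2)) :=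
    Finset.measurable_prod _ fun j _ => hm.comp (measurable_pi_apply j)
  rw [gaussianMatrix, hrow, pi_withDensity hrm, ← volume_pi]
  congr 1
  funext V
  simp only [frobSq, Finset.mul_sum, gaussWeight_sum, Finset.prod_mul_distrib, Finset.prod_const,
    Finset.card_univ, Fintype.card_fin, Matrix.of_apply]
  rw [← pow_mul, mul_comm n m, ENNReal.ofReal_pow ha0]

lemma measurable_gaussWeight_frobSq (m n : ℕ) (a : ℝ) :
    Measurable fun V : Fin m → Fin n → ℂ => gaussWeight (a * frobSq (Matrix.of V)) := by
  refine measurable_gaussWeight.comp ?_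
  unfold frobSq
  refine Continuous.measurable ?_
  simp only [Matrix.of_apply]
  fun_prop

/-- No measurability of `f` is needed. -/
lemma lintegral_gaussianMatrix (m n : ℕ) {σ a : ℝ} (hσ : 0 < σ) (ha : a = (2 * σ ^ 2)⁻¹)
    (f : (Fin m → Fin n → ℂ) → ℝ≥0∞) :
    ∫⁻ V, f V ∂(gaussianMatrix m n σ) = ENNReal.ofReal ((a / Real.pi) ^ (m * n)) *
      ∫⁻ V, gaussWeight (a * frobSq (Matrix.of V)) * f V := by
  rw [gaussianMatrix_eq_withDensity m n hσ ha,
    lintegral_withDensity_eq_lintegral_mul_non_measurable _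
      ((measurable_gaussWeight_frobSq m n a).const_mul _)
      (Eventually.of_forall fun V => ENNReal.mul_lt_top ENNReal.ofReal_lt_top
        (gaussWeight_ne_top _).lt_top),
    ← lintegral_const_mul' _ _ ENNReal.ofReal_ne_top]
  refine lintegral_congr fun V => ?_
  simp only [Pi.mul_apply, mul_assoc]

lemma lintegral_gaussWeight_frobSq (m n : ℕ) {a : ℝ} (ha : 0 < a) :
    ∫⁻ V : Fin m → Fin n → ℂ, gaussWeight (a * frobSq (Matrix.of V)) =
      ENNReal.ofReal ((Real.pi / a) ^ (m * n)) := by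
  have hsplit : ∀ V : Fin m → Fin n → ℂ, gaussWeight (a * frobSq (Matrix.of V)) =
      ∏ i, gaussWeight (a * ∑ j, ‖V i j‖ ^ 2) := fun V => by
    rw [frobSq, Finset.mul_sum, gaussWeight_sum]
    rfl
  simp_rw [hsplit]
  rw [volume_pi, lintegral_pi_prod (μ := (volume : Measure (Fin n → ℂ)))
    (f := fun _ x => gaussWeight (a * ∑ j, ‖x j‖ ^ 2)) fun _ =>
    measurable_gaussWeight.comp (by fun_prop), lintegral_gaussWeight_pi ha]
  rw [Finset.prod_const, Finset.card_univ, Fintype.card_fin, Fintype.card_fin, ← ENNReal.ofReal_pow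
    (by positivity), ← pow_mul, mul_comm n m]

/-- A complex linear change of variables has real Jacobian `|det L|²`. -/
lemma lintegral_comp_complexLinear {E : Type*} [NormedAddCommGroup E] [NormedSpace ℝ E]
    [Module ℂ E] [IsScalarTower ℝ ℂ E] [FiniteDimensional ℝ E] [MeasurableSpace E] [BorelSpace E]
    (μ : Measure E) [μ.IsAddHaarMeasure] {L : E →ₗ[ℂ] E} (hL : LinearMap.det L ≠ 0)
    {f : E → ℝ≥0∞} (hf : Measurable f) :
    ∫⁻ x, f (L x) ∂μ = ENNReal.ofReal ((‖LinearMap.det L‖ ^ 2)⁻¹) * ∫⁻ x, f x ∂μ := by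
  have hdet : LinearMap.det (L.restrictScalars ℝ) = ‖LinearMap.det L‖ ^ 2 := by
    rw [LinearMap.det_restrictScalars, Algebra.norm_complex_apply, Complex.normSq_eq_norm_sq]
  have hne : LinearMap.det (L.restrictScalars ℝ) ≠ 0 := by
    rw [hdet]
    exact pow_ne_zero _ (norm_ne_zero_iff.2 hL)
  have hmap := Measure.map_linearMap_addHaar_eq_smul_addHaar μ hne
  have hm : Measurable (L.restrictScalars ℝ) :=
    (L.restrictScalars ℝ).continuous_of_finiteDimensional.measurable
  have h1 := lintegral_map (μ := μ) hf hm
  rw [hmap, lintegral_smul_measure, hdet, abs_of_nonneg (by positivity)] at h1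
  exact h1.symm

/-- Gaussian projection. If `q` splits as `q v = q (A (π v)) + q (v - A (π v))`, the image under
`π` of the measure with density `exp (-q)` has a density proportional to `exp (-q ∘ A)`: the fibre
integrals of `exp (-q (v - A (π v)))` form a translation invariant measure on `F`. -/
lemma exists_lintegral_gaussWeight_comp_proj {E F : Type*} [NormedAddCommGroup E] [NormedSpace ℝ E]
    [FiniteDimensional ℝ E] [MeasurableSpace E] [BorelSpace E] [NormedAddCommGroup F]
    [NormedSpace ℝ F] [FiniteDimensional ℝ F] [MeasurableSpace F] [BorelSpace F]
    (μ : Measure E) [μ.IsAddHaarMeasure] (ν : Measure F) [ν.IsAddHaarMeasure]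
    (A : F →ₗ[ℝ] E) (π : E →ₗ[ℝ] F) (hπ : ∀ x, π (A x) = x) {q : E → ℝ} (hqc : Continuous q)
    (hq : ∀ v, q v = q (A (π v)) + q (v - A (π v)))
    (hfin : ∫⁻ v, gaussWeight (q v) ∂μ ≠ ∞) :
    ∃ k : ℝ≥0∞, ∀ g : F → ℝ≥0∞, Measurable g →
      ∫⁻ v, gaussWeight (q v) * g (π v) ∂μ = k * ∫⁻ x, gaussWeight (q (A x)) * g x ∂ν := by
  have hA : Continuous A := A.continuous_of_finiteDimensional
  have hπc : Continuous π := π.continuous_of_finiteDimensional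
  set w : E → ℝ≥0∞ := fun v => gaussWeight (q (v - A (π v))) with hw
  have hwm : Measurable w := measurable_gaussWeight.comp (Continuous.measurable (by fun_prop))
  set ν' := (μ.withDensity w).map π with hν'
  have hν'l : ∀ g : F → ℝ≥0∞, Measurable g → ∫⁻ x, g x ∂ν' = ∫⁻ v, w v * g (π v) ∂μ := by
    intro g hg
    rw [hν', lintegral_map hg hπc.measurable,
      lintegral_withDensity_eq_lintegral_mul (g := fun v => g (π v)) _ hwm
        (hg.comp hπc.measurable)]
    rfl
  have inv : ν'.IsAddLeftInvariant := by
    refine ⟨fun u => Measure.ext fun B hB => ?_⟩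
    rw [Measure.map_apply (measurable_const_add u) hB, ← lintegral_indicator_one hB,
      ← lintegral_indicator_one (measurable_const_add u hB),
      hν'l _ (measurable_one.indicator hB),
      hν'l _ (measurable_one.indicator (measurable_const_add u hB)),
      ← lintegral_add_left_eq_self (fun v => w v * B.indicator 1 (π v)) (A u)]
    refine lintegral_congr fun v => ?_
    have e1 : w (A u + v) = w v := by
      simp only [hw, map_add, hπ]
      congr 2
      abel
    rw [e1, map_add, hπ]
    rfl
  have fin : IsFiniteMeasureOnCompacts ν' := by
    refine ⟨fun K hK => ?_⟩
    obtain ⟨C, hC⟩ := hK.bddAbove_image (f := fun x => q (A x)) (by fun_prop)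
    rw [← lintegral_indicator_one hK.measurableSet,
      hν'l _ (measurable_one.indicator hK.measurableSet)]
    refine lt_of_le_of_lt (b := ∫⁻ v, gaussWeight (-C) * gaussWeight (q v) ∂μ)
      (lintegral_mono fun v => ?_) ?_
    · by_cases hv : π v ∈ K
      · rw [Set.indicator_of_mem hv, Pi.one_apply, mul_one, ← gaussWeight_add]
        refine gaussWeight_anti ?_
        have : q (A (π v)) ≤ C := hC ⟨π v, hv, rfl⟩
        rw [hq v]
        linarith
      · rw [Set.indicator_of_notMem hv, mul_zero]
        exact zero_le
    · rw [lintegral_const_mul' _ _ (gaussWeight_ne_top _)]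
      exact ENNReal.mul_lt_top (gaussWeight_ne_top _).lt_top hfin.lt_top
  refine ⟨(Measure.addHaarScalarFactor ν' ν : ℝ≥0∞), fun g hg => ?_⟩
  have hm : Measurable fun x => gaussWeight (q (A x)) * g x :=
    (measurable_gaussWeight.comp (Continuous.measurable (by fun_prop))).mul hg
  have h1 := hν'l _ hm
  rw [Measure.isAddLeftInvariant_eq_smul ν' ν, lintegral_smul_measure] at h1
  rw [show ((Measure.addHaarScalarFactor ν' ν : ℝ≥0∞) * ∫⁻ x, gaussWeight (q (A x)) * g x ∂ν) =
    Measure.addHaarScalarFactor ν' ν • ∫⁻ x, gaussWeight (q (A x)) * g x ∂ν from rfl, h1]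
  refine lintegral_congr fun v => ?_
  rw [hq v, gaussWeight_add]
  ring

/-! ### Moments of the determinant of a complex Wishart matrix -/

section Gram

variable {W : Type*} [NormedAddCommGroup W] [InnerProductSpace ℂ W]

/-- Subtracting from `h` its projection onto the span of the `v i` is a row operation on the Gram
matrix. -/
lemma det_gram_cons {m : ℕ} (v : Fin m → W) (h t : W) (a : Fin m → ℂ)
    (hh : h = t + ∑ i, a i • v i) (ht : ∀ i, inner ℂ t (v i) = 0) :
    (Matrix.gram ℂ (Fin.cons h v : Fin (m + 1) → W)).det =
      (‖t‖ ^ 2 : ℝ) * (Matrix.gram ℂ v).det := by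
  set G := Matrix.gram ℂ (Fin.cons h v : Fin (m + 1) → W) with hG
  let c : Fin (m + 1) → ℂ := Fin.cons 1 fun i => -(starRingEnd ℂ) (a i)
  have h1 := Matrix.det_updateRow_sum G 0 c
  have hrow : ∑ k, c k • G k = fun j => inner ℂ t ((Fin.cons h v : Fin (m + 1) → W) j) := by
    funext j
    rw [Finset.sum_apply, Fin.sum_univ_succ]
    simp only [c, Fin.cons_zero, Fin.cons_succ, Pi.smul_apply, hG, Matrix.gram_apply, smul_eq_mul,
      one_mul]
    have ht' : t = h - ∑ i, a i • v i := by rw [hh]; abel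
    rw [ht', inner_sub_left, sum_inner]
    simp only [inner_smul_left, neg_mul, Finset.sum_neg_distrib, sub_eq_add_neg]
  rw [hrow] at h1
  have hc0 : c 0 = 1 := rfl
  rw [hc0, one_smul] at h1
  rw [← h1, Matrix.det_succ_row_zero, Fin.sum_univ_succ]
  have hth : inner ℂ t h = ((‖t‖ ^ 2 : ℝ) : ℂ) := by
    rw [hh, inner_add_right, inner_sum]
    simp only [inner_smul_right, ht, mul_zero, Finset.sum_const_zero, add_zero]
    rw [inner_self_eq_norm_sq_to_K]
    norm_cast
  have hsub : (G.updateRow 0 fun j => inner ℂ t ((Fin.cons h v : Fin (m + 1) → W) j)).submatrix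
      Fin.succ (Fin.succAbove 0) = Matrix.gram ℂ v := by
    ext i j
    simp [hG, Matrix.gram_apply, Matrix.updateRow_ne]
  have hzero : ∀ j : Fin m, inner ℂ t ((Fin.cons h v : Fin (m + 1) → W) j.succ) = 0 := fun j => by
    simpa using ht j
  rw [Finset.sum_eq_zero fun j _ => ?_, add_zero, hsub]
  · simp [hth]
  · rw [Matrix.updateRow_self, hzero, mul_zero, zero_mul]

end Gram

/-- Radial Gaussian moments in complex dimension `m`. -/
lemma lintegral_norm_pow_mul_gaussWeight {K : Type*} [NormedAddCommGroup K] [NormedSpace ℝ K]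
    [FiniteDimensional ℝ K] [MeasurableSpace K] [BorelSpace K] (ν : Measure K)
    [ν.IsAddHaarMeasure] {m : ℕ} (hm : 0 < m) (hK : Module.finrank ℝ K = 2 * m) {a : ℝ}
    (ha : 0 < a) (T : ℕ) :
    ∫⁻ t, gaussWeight (a * ‖t‖ ^ 2) * ENNReal.ofReal ((‖t‖ ^ 2) ^ T) ∂ν =
      ENNReal.ofReal (Real.Gamma (m + T) / Real.Gamma m * (a ^ T)⁻¹) *
        ∫⁻ t, gaussWeight (a * ‖t‖ ^ 2) ∂ν := by
  have hnt : Nontrivial K := Module.nontrivial_of_finrank_pos (R := ℝ) (by omega)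
  have hfn : ∀ S : ℕ, ∀ y ∈ Set.Ioi (0 : ℝ),
      y ^ (2 * m - 1) • (Real.exp (-(a * y ^ 2)) * (y ^ 2) ^ S) =
        y ^ ((2 * m - 1 + 2 * S : ℕ) : ℝ) * Real.exp (-a * y ^ (2 : ℝ)) := by
    intro S y _
    rw [Real.rpow_natCast, pow_add, pow_mul, smul_eq_mul, Real.rpow_two]
    ring_nf
  have hint : ∀ S : ℕ, Integrable (fun t : K => Real.exp (-(a * ‖t‖ ^ 2)) * (‖t‖ ^ 2) ^ S) ν := by
    intro S
    rw [integrable_fun_norm_addHaar ν (f := fun y => Real.exp (-(a * y ^ 2)) * (y ^ 2) ^ S), hK,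
      integrableOn_congr_fun (hfn S) measurableSet_Ioi]
    exact integrableOn_rpow_mul_exp_neg_mul_rpow (by
      have : (0 : ℝ) ≤ ((2 * m - 1 + 2 * S : ℕ) : ℝ) := Nat.cast_nonneg _
      linarith) (by norm_num) ha
  have hval : ∀ S : ℕ, ∫ t : K, Real.exp (-(a * ‖t‖ ^ 2)) * (‖t‖ ^ 2) ^ S ∂ν =
      (2 * m : ℕ) • ν.real (Metric.ball 0 1) •
        (a ^ (-((m : ℝ) + S)) * (1 / 2) * Real.Gamma (m + S)) := by
    intro S
    rw [integral_fun_norm_addHaar ν (fun y => Real.exp (-(a * y ^ 2)) * (y ^ 2) ^ S), hK,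
      setIntegral_congr_fun measurableSet_Ioi (hfn S),
      integral_rpow_mul_exp_neg_mul_rpow (by norm_num) (by
        have : (0 : ℝ) ≤ ((2 * m - 1 + 2 * S : ℕ) : ℝ) := Nat.cast_nonneg _
        linarith) ha]
    have e : (((2 * m - 1 + 2 * S : ℕ) : ℝ) + 1) / 2 = m + S := by
      rw [show (((2 * m - 1 + 2 * S : ℕ) : ℝ) + 1) = ((2 * m - 1 + 2 * S + 1 : ℕ) : ℝ) by
        push_cast; ring, show 2 * m - 1 + 2 * S + 1 = 2 * (m + S) by omega]
      push_cast
      ring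
    rw [e, neg_div, e]
  have hl : ∀ S : ℕ, ∫⁻ t, gaussWeight (a * ‖t‖ ^ 2) * ENNReal.ofReal ((‖t‖ ^ 2) ^ S) ∂ν =
      ENNReal.ofReal (∫ t : K, Real.exp (-(a * ‖t‖ ^ 2)) * (‖t‖ ^ 2) ^ S ∂ν) := by
    intro S
    rw [ofReal_integral_eq_lintegral_ofReal (hint S)
      (Eventually.of_forall fun t => by positivity)]
    refine lintegral_congr fun t => ?_
    rw [gaussWeight, ← ENNReal.ofReal_mul (Real.exp_nonneg _)]
  have h0 := hl 0
  simp only [pow_zero, ENNReal.ofReal_one, mul_one] at h0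
  have hv0 := hval 0
  simp only [pow_zero, mul_one] at hv0
  have hG : 0 < Real.Gamma m := Real.Gamma_pos_of_pos (by exact_mod_cast hm)
  have hG' : 0 < Real.Gamma (m + T) := Real.Gamma_pos_of_pos (by positivity)
  rw [hl T, h0, hval T, hv0, ← ENNReal.ofReal_mul (by positivity)]
  congr 1
  rw [Real.rpow_neg ha.le, Real.rpow_neg ha.le, Real.rpow_add ha, Real.rpow_add ha]
  simp only [nsmul_eq_mul, smul_eq_mul, Nat.cast_zero, add_zero, Real.rpow_natCast, Real.rpow_zero]
  field_simp

/-- The determinant of the Gram matrix of the vectors `C i`. -/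
noncomputable def gramDet {m n : ℕ} (C : Fin m → Fin n → ℂ) : ℝ :=
  (Matrix.gram ℂ fun i => WithLp.toLp 2 (C i)).det.re

lemma gramDet_cast {m n : ℕ} (C : Fin m → Fin n → ℂ) :
    ((gramDet C : ℝ) : ℂ) = (Matrix.gram ℂ fun i => WithLp.toLp 2 (C i)).det := by
  have h := (Matrix.posSemidef_gram ℂ fun i => WithLp.toLp 2 (C i)).det_nonneg
  exact (Complex.eq_re_of_ofReal_le (r := 0) (by simpa using h)).symm

lemma gramDet_ne_zero_iff {m n : ℕ} (C : Fin m → Fin n → ℂ) :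
    gramDet C ≠ 0 ↔
      LinearIndependent ℂ fun i => (WithLp.toLp 2 (C i) : EuclideanSpace ℂ (Fin n)) := by
  rw [← Matrix.det_gram_ne_zero_iff_linearIndependent, ← gramDet_cast, Complex.ofReal_ne_zero]

lemma measurable_gramDet {m n : ℕ} :
    Measurable (gramDet : (Fin m → Fin n → ℂ) → ℝ) := by
  refine Continuous.measurable ?_
  unfold gramDet
  refine Complex.continuous_re.comp (Continuous.matrix_det ?_)
  refine continuous_matrix fun i j => ?_
  simp only [Matrix.gram_apply]
  refine Continuous.inner ?_ ?_ <;>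
    exact (PiLp.continuous_toLp 2 _).comp (continuous_apply _)

lemma toLp_comp_cons {m n : ℕ} (h : Fin n → ℂ) (C : Fin m → Fin n → ℂ) :
    (fun i => (WithLp.toLp 2 ((Fin.cons h C : Fin (m + 1) → Fin n → ℂ) i) :
      EuclideanSpace ℂ (Fin n))) = Fin.cons (WithLp.toLp 2 h) fun i => WithLp.toLp 2 (C i) := by
  funext i
  refine Fin.cases ?_ (fun j => ?_) i <;> simp

/-- Integrating out one column: given independent columns `C`, the Gram determinant gains as a
factor the squared norm of the Gaussian projection of `h` to a complex subspace of dimension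
`n - m`. -/
lemma lintegral_gramDet_cons {m n : ℕ} (hmn : m < n) {a : ℝ} (ha : 0 < a) {T : ℕ} (hT : 0 < T)
    (C : Fin m → Fin n → ℂ) :
    ∫⁻ h : Fin n → ℂ, gaussWeight (a * ∑ i, ‖h i‖ ^ 2) *
        ENNReal.ofReal (gramDet (Fin.cons h C : Fin (m + 1) → Fin n → ℂ) ^ T) =
      ENNReal.ofReal (Real.Gamma ((n - m : ℕ) + T) / Real.Gamma (n - m : ℕ) * (a ^ T)⁻¹ *
        (Real.pi / a) ^ n) * ENNReal.ofReal (gramDet C ^ T) := by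
  by_cases hC : gramDet C = 0
  · have hz : ∀ h : Fin n → ℂ, gramDet (Fin.cons h C : Fin (m + 1) → Fin n → ℂ) = 0 := by
      intro h
      by_contra hne
      rw [← ne_eq, gramDet_ne_zero_iff, toLp_comp_cons, linearIndependent_finCons] at hne
      exact (gramDet_ne_zero_iff C).2 hne.1 hC
    simp [hz, hC, hT.ne']
  have hli := (gramDet_ne_zero_iff C).1 hC
  set v : Fin m → EuclideanSpace ℂ (Fin n) := fun i => WithLp.toLp 2 (C i) with hv
  let K : Submodule ℂ (EuclideanSpace ℂ (Fin n)) := (Submodule.span ℂ (Set.range v))ᗮ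
  have hKfin : Module.finrank ℂ K = n - m := by
    have h1 := Submodule.finrank_add_finrank_orthogonal (Submodule.span ℂ (Set.range v))
    rw [finrank_span_eq_card hli, finrank_euclideanSpace] at h1
    simp only [Fintype.card_fin] at h1
    change m + Module.finrank ℂ K = n at h1
    omega
  have hKfinR : Module.finrank ℝ K = 2 * (n - m) := by
    rw [← hKfin, ← Complex.finrank_real_complex, Module.finrank_mul_finrank]
  have : FiniteDimensional ℝ K := Module.finite_of_finrank_pos (by omega)
  let e := WithLp.linearEquiv 2 ℝ (Fin n → ℂ)
  let A : K →ₗ[ℝ] (Fin n → ℂ) := e.toLinearMap ∘ₗ (K.subtype.restrictScalars ℝ)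
  let P : (Fin n → ℂ) →ₗ[ℝ] K :=
    (K.orthogonalProjectionOnto.toLinearMap.restrictScalars ℝ) ∘ₗ e.symm.toLinearMap
  let q : (Fin n → ℂ) → ℝ := fun h => a * ‖(WithLp.toLp 2 h : EuclideanSpace ℂ (Fin n))‖ ^ 2
  have hqs : ∀ h, q h = a * ∑ i, ‖h i‖ ^ 2 := fun h => by
    simp only [q, EuclideanSpace.norm_sq_eq]
  have hqA : ∀ x : K, q (A x) = a * ‖x‖ ^ 2 := fun x => rfl
  have hqc : Continuous q := by
    have : q = fun h => a * ∑ i, ‖h i‖ ^ 2 := funext hqs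
    rw [this]
    fun_prop
  have hPA : ∀ x, P (A x) = x := fun x => K.orthogonalProjectionOnto_mem_subspace_eq_self x
  have hPe : ∀ h : Fin n → ℂ, ((P h : K) : EuclideanSpace ℂ (Fin n)) =
      K.orthogonalProjectionOnto (WithLp.toLp 2 h) := fun h => rfl
  have hsub : ∀ h : Fin n → ℂ, (WithLp.toLp 2 (h - A (P h)) : EuclideanSpace ℂ (Fin n)) =
      WithLp.toLp 2 h - K.orthogonalProjectionOnto (WithLp.toLp 2 h) := fun h => rfl
  have horth : ∀ h : Fin n → ℂ, (WithLp.toLp 2 h : EuclideanSpace ℂ (Fin n)) -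
      K.orthogonalProjectionOnto (WithLp.toLp 2 h) ∈ Kᗮ := fun h =>
    K.sub_starProjection_mem_orthogonal _
  have hq : ∀ h, q h = q (A (P h)) + q (h - A (P h)) := by
    intro h
    have h1 : inner ℂ (K.orthogonalProjectionOnto (WithLp.toLp 2 h) : EuclideanSpace ℂ (Fin n))
        (WithLp.toLp 2 h - K.orthogonalProjectionOnto (WithLp.toLp 2 h)) = 0 :=
      Submodule.inner_right_of_mem_orthogonal (SetLike.coe_mem _) (horth h)
    have h2 := norm_add_sq_eq_norm_sq_add_norm_sq_of_inner_eq_zero _ _ h1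
    rw [add_sub_cancel] at h2
    have h3 : q (A (P h)) = a * ‖(K.orthogonalProjectionOnto (WithLp.toLp 2 h) :
      EuclideanSpace ℂ (Fin n))‖ ^ 2 := rfl
    rw [h3]
    simp only [q, hsub]
    rw [← mul_add]
    congr 1
    simpa only [sq] using h2
  have hfin : ∫⁻ h, gaussWeight (q h) = ENNReal.ofReal ((Real.pi / a) ^ n) := by
    simp_rw [hqs]
    rw [lintegral_gaussWeight_pi ha, Fintype.card_fin]
  obtain ⟨k, hk⟩ := exists_lintegral_gaussWeight_comp_proj (volume : Measure (Fin n → ℂ))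
    (Measure.addHaar : Measure K) A P hPA hqc hq (by rw [hfin]; exact ENNReal.ofReal_ne_top)
  have hk1 := hk (fun _ => 1) measurable_const
  have hkT := hk (fun x => ENNReal.ofReal ((‖x‖ ^ 2) ^ T)) (by fun_prop)
  simp only [mul_one, hqA] at hk1
  simp only [hqA] at hkT
  rw [lintegral_norm_pow_mul_gaussWeight _ (by omega) hKfinR ha T, mul_left_comm, ← hk1, hfin]
    at hkT
  have hgram : ∀ h : Fin n → ℂ, gramDet (Fin.cons h C : Fin (m + 1) → Fin n → ℂ) =
      ‖P h‖ ^ 2 * gramDet C := by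
    intro h
    have hmem := horth h
    rw [Submodule.orthogonal_orthogonal, Submodule.mem_span_range_iff_exists_fun] at hmem
    obtain ⟨b, hb⟩ := hmem
    have h1 := det_gram_cons v (WithLp.toLp 2 h) (K.orthogonalProjectionOnto (WithLp.toLp 2 h)) b
      (by rw [hb]; abel) (fun i => Submodule.inner_left_of_mem_orthogonal
        (Submodule.subset_span (Set.mem_range_self i)) (SetLike.coe_mem _))
    apply Complex.ofReal_injective
    rw [gramDet_cast, toLp_comp_cons, h1, Complex.ofReal_mul, gramDet_cast]
    rfl
  have hΓ : 0 ≤ Real.Gamma ((n - m : ℕ) + T) / Real.Gamma (n - m : ℕ) * (a ^ T)⁻¹ := by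
    have : 0 < n - m := by omega
    have h1 : 0 < Real.Gamma (n - m : ℕ) := Real.Gamma_pos_of_pos (by exact_mod_cast this)
    have h2 : 0 < Real.Gamma ((n - m : ℕ) + T) := Real.Gamma_pos_of_pos (by positivity)
    positivity
  rw [ENNReal.ofReal_mul hΓ, ← hkT, ← lintegral_mul_const' _ _ ENNReal.ofReal_ne_top]
  refine lintegral_congr fun h => ?_
  rw [hgram, mul_pow, ENNReal.ofReal_mul (by positivity), hqs]
  ring

/-- Gaussian integral of the `T`-th power of the Gram determinant of `m` columns in `ℂ^n`. -/
lemma lintegral_gramDet_pow {m n : ℕ} (hmn : m ≤ n) {a : ℝ} (ha : 0 < a) {T : ℕ} (hT : 0 < T) :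
    ∫⁻ C : Fin m → Fin n → ℂ, gaussWeight (a * frobSq (Matrix.of C)) *
        ENNReal.ofReal (gramDet C ^ T) =
      ∏ k ∈ Finset.range m, ENNReal.ofReal (Real.Gamma ((n - k : ℕ) + T) /
        Real.Gamma (n - k : ℕ) * (a ^ T)⁻¹ * (Real.pi / a) ^ n) := by
  induction m with
  | zero =>
    have h1 : volume (Set.univ : Set (Fin 0 → Fin n → ℂ)) = 1 := by
      rw [volume_pi, Measure.pi_univ]
      simp
    simp [frobSq, gaussWeight, gramDet, h1]
  | succ m ih =>
    have hmeas : Measurable fun p : (Fin n → ℂ) × (Fin m → Fin n → ℂ) =>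
        gaussWeight (a * frobSq (Matrix.of (Fin.cons p.1 p.2 : Fin (m + 1) → Fin n → ℂ))) *
          ENNReal.ofReal (gramDet (Fin.cons p.1 p.2 : Fin (m + 1) → Fin n → ℂ) ^ T) := by
      have hc : Measurable fun p : (Fin n → ℂ) × (Fin m → Fin n → ℂ) =>
          (Fin.cons p.1 p.2 : Fin (m + 1) → Fin n → ℂ) :=
        Continuous.measurable (by fun_prop)
      exact ((measurable_gaussWeight_frobSq _ _ a).comp hc).mul
        ((measurable_gramDet.comp hc).pow_const T).ennreal_ofReal
    have hfrob : ∀ (h : Fin n → ℂ) (C : Fin m → Fin n → ℂ),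
        frobSq (Matrix.of (Fin.cons h C : Fin (m + 1) → Fin n → ℂ)) =
          ∑ i, ‖h i‖ ^ 2 + frobSq (Matrix.of C) := by
      intro h C
      simp [frobSq, Fin.sum_univ_succ]
    rw [volume_pi, ((measurePreserving_piFinSuccAbove (fun _ : Fin (m + 1) =>
        (volume : Measure (Fin n → ℂ))) 0).symm
        (MeasurableEquiv.piFinSuccAbove (fun _ => Fin n → ℂ) 0)).lintegral_map_equiv
        (fun C => gaussWeight (a * frobSq (Matrix.of C)) * ENNReal.ofReal (gramDet C ^ T))]
    have hcons : ∀ p : (Fin n → ℂ) × (Fin m → Fin n → ℂ),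
        (MeasurableEquiv.piFinSuccAbove (fun _ : Fin (m + 1) => Fin n → ℂ) 0).symm p =
          Fin.cons p.1 p.2 := by
      intro p
      funext i
      refine Fin.cases ?_ (fun j => ?_) i <;> rfl
    simp_rw [hcons]
    rw [lintegral_prod_symm _ hmeas.aemeasurable]
    simp only [hfrob, mul_add, gaussWeight_add]
    have inner : ∀ C : Fin m → Fin n → ℂ,
        ∫⁻ h : Fin n → ℂ, gaussWeight (a * ∑ i, ‖h i‖ ^ 2) * gaussWeight (a * frobSq (Matrix.of C)) *
          ENNReal.ofReal (gramDet (Fin.cons h C : Fin (m + 1) → Fin n → ℂ) ^ T) =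
        ENNReal.ofReal (Real.Gamma ((n - m : ℕ) + T) / Real.Gamma (n - m : ℕ) * (a ^ T)⁻¹ *
          (Real.pi / a) ^ n) *
          (gaussWeight (a * frobSq (Matrix.of C)) * ENNReal.ofReal (gramDet C ^ T)) := by
      intro C
      rw [mul_left_comm, ← lintegral_gramDet_cons (by omega) ha hT C,
        ← lintegral_const_mul' _ _ (gaussWeight_ne_top _)]
      refine lintegral_congr fun h => ?_
      ring
    simp_rw [inner]
    rw [lintegral_const_mul' _ _ ENNReal.ofReal_ne_top]
    change _ * ∫⁻ C : Fin m → Fin n → ℂ, _ = _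
    rw [ih (by omega), Finset.prod_range_succ, mul_comm]

/-- Almost every tuple of at most `n` vectors of `ℂ^n` is linearly independent. -/
lemma ae_gramDet_ne_zero {m n : ℕ} (hmn : m ≤ n) :
    ∀ᵐ C : Fin m → Fin n → ℂ, gramDet C ≠ 0 := by
  induction m with
  | zero => exact Eventually.of_forall fun C => by simp [gramDet]
  | succ m ih =>
    have hmp := (measurePreserving_piFinSuccAbove (fun _ : Fin (m + 1) =>
        (volume : Measure (Fin n → ℂ))) 0)
    have hc : Measurable fun p : (Fin m → Fin n → ℂ) × (Fin n → ℂ) =>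
          (Fin.cons p.2 p.1 : Fin (m + 1) → Fin n → ℂ) :=
        Continuous.measurable (by fun_prop)
    have hprod : ∀ᵐ p : (Fin m → Fin n → ℂ) × (Fin n → ℂ) ∂(volume.prod volume),
        gramDet (Fin.cons p.2 p.1 : Fin (m + 1) → Fin n → ℂ) ≠ 0 := by
      rw [Measure.ae_prod_iff_ae_ae (p := fun p : (Fin m → Fin n → ℂ) × (Fin n → ℂ) =>
        gramDet (Fin.cons p.2 p.1 : Fin (m + 1) → Fin n → ℂ) ≠ 0)
        ((measurable_gramDet.comp hc) (measurableSet_singleton 0)).compl]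
      filter_upwards [ih (by omega)] with C hC
      have hli := (gramDet_ne_zero_iff C).1 hC
      set v : Fin m → EuclideanSpace ℂ (Fin n) := fun i => WithLp.toLp 2 (C i) with hv
      let e := WithLp.linearEquiv 2 ℂ (Fin n → ℂ)
      let S : Submodule ℝ (Fin n → ℂ) :=
        ((Submodule.span ℂ (Set.range v)).comap e.symm.toLinearMap).restrictScalars ℝ
      have hS : S ≠ ⊤ := by
        intro hS
        have htop : Submodule.span ℂ (Set.range v) = ⊤ := by
          rw [eq_top_iff]
          intro x _
          have : e x ∈ S := by rw [hS]; trivial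
          simpa [S] using this
        have := finrank_span_eq_card hli
        rw [htop, finrank_top, finrank_euclideanSpace] at this
        simp only [Fintype.card_fin] at this
        omega
      have hnull := Measure.addHaar_submodule (volume : Measure (Fin n → ℂ)) S hS
      filter_upwards [measure_eq_zero_iff_ae_notMem.1 hnull] with h hh
      rw [gramDet_ne_zero_iff, toLp_comp_cons, linearIndependent_finCons]
      exact ⟨hli, fun hmem => hh hmem⟩
    have h2 := (hmp.quasiMeasurePreserving.ae (p := fun p : (Fin n → ℂ) × (Fin m → Fin n → ℂ) =>
      gramDet (Fin.cons p.1 p.2 : Fin (m + 1) → Fin n → ℂ) ≠ 0)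
      (Measure.measurePreserving_swap.quasiMeasurePreserving.ae hprod))
    filter_upwards [h2] with C hC
    have : (Fin.cons (MeasurableEquiv.piFinSuccAbove (fun _ : Fin (m + 1) => Fin n → ℂ) 0 C).1
        (MeasurableEquiv.piFinSuccAbove (fun _ : Fin (m + 1) => Fin n → ℂ) 0 C).2 :
        Fin (m + 1) → Fin n → ℂ) = C := by
      funext i
      refine Fin.cases ?_ (fun j => ?_) i <;> rfl
    rwa [this] at hC

instance isAddHaarMeasure_volume_matrix (m n : ℕ) :
    (volume : Measure (Fin m → Fin n → ℂ)).IsAddHaarMeasure :=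
  Measure.pi.isAddHaarMeasure fun _ : Fin m => (volume : Measure (Fin n → ℂ))

/-- Transposition preserves Lebesgue measure on matrices. -/
lemma measurePreserving_transpose (m n : ℕ) :
    MeasurePreserving (fun (H : Fin m → Fin n → ℂ) j i => H i j) volume volume := by
  let e : (Fin m → Fin n → ℂ) ≃L[ℝ] (Fin n → Fin m → ℂ) :=
    LinearEquiv.toContinuousLinearEquiv
      { toFun := fun H j i => H i j
        invFun := fun H j i => H i j
        map_add' := fun _ _ => rfl
        map_smul' := fun _ _ => rfl
        left_inv := fun _ => rfl
        right_inv := fun _ => rfl }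
  have he : (fun (H : Fin m → Fin n → ℂ) j i => H i j) = e := rfl
  refine ⟨he ▸ e.continuous.measurable, ?_⟩
  rw [he]
  have hball : e ⁻¹' Metric.ball 0 1 = Metric.ball 0 1 := by
    ext H
    simp only [Set.mem_preimage, mem_ball_zero_iff, pi_norm_lt_iff one_pos]
    exact ⟨fun h i j => h j i, fun h i j => h j i⟩
  have hvol : ∀ k l : ℕ, volume (Metric.ball (0 : Fin k → Fin l → ℂ) 1) =
      (volume (Metric.ball (0 : ℂ) 1)) ^ (l * k) := by
    intro k l
    rw [volume_pi_ball _ one_pos]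
    simp only [Pi.zero_apply, volume_pi_ball _ one_pos, Finset.prod_const, Finset.card_univ,
      Fintype.card_fin, ← pow_mul]
  have hhaar : (Measure.map e (volume : Measure (Fin m → Fin n → ℂ))).IsAddHaarMeasure :=
    e.isAddHaarMeasure_map _
  have h1 := Measure.isAddLeftInvariant_eq_smul (Measure.map e volume)
    (volume : Measure (Fin n → Fin m → ℂ))
  have h2 := congrArg (fun μ : Measure (Fin n → Fin m → ℂ) => μ (Metric.ball 0 1)) h1
  simp only [Measure.smul_apply] at h2
  rw [Measure.map_apply e.continuous.measurable measurableSet_ball, hball, hvol, hvol,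
    mul_comm m n] at h2
  have hb0 : volume (Metric.ball (0 : ℂ) 1) ^ (n * m) ≠ 0 :=
    pow_ne_zero _ (Metric.measure_ball_pos _ _ one_pos).ne'
  have hbt : volume (Metric.ball (0 : ℂ) 1) ^ (n * m) ≠ ∞ :=
    ENNReal.pow_ne_top measure_ball_lt_top.ne
  have h3 : ((Measure.addHaarScalarFactor (Measure.map e volume)
      (volume : Measure (Fin n → Fin m → ℂ)) : NNReal) : ℝ≥0∞) = 1 := by
    have h4 : (1 : ℝ≥0∞) * volume (Metric.ball (0 : ℂ) 1) ^ (n * m) =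
      ((Measure.addHaarScalarFactor (Measure.map e volume)
      (volume : Measure (Fin n → Fin m → ℂ)) : NNReal) : ℝ≥0∞) *
        volume (Metric.ball (0 : ℂ) 1) ^ (n * m) := by
      rw [one_mul]; exact h2
    exact ((ENNReal.mul_left_inj hb0 hbt).1 h4).symm
  rw [h1, ENNReal.coe_eq_one.1 h3, one_smul]

lemma gramDet_transpose {m n : ℕ} (H : Fin n → Fin m → ℂ) :
    gramDet (fun j i => H i j) = ((Matrix.of H)ᴴ * Matrix.of H).det.re := by
  rw [gramDet]
  congr 2
  ext i j
  simp [Matrix.gram_apply, Matrix.mul_apply, PiLp.inner_apply, mul_comm]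

lemma frobSq_transpose {m n : ℕ} (H : Fin n → Fin m → ℂ) :
    frobSq (Matrix.of fun j i => H i j) = frobSq (Matrix.of H) := by
  simp only [frobSq, Matrix.of_apply]
  exact Finset.sum_comm

/-- The moments of the determinant of a complex Wishart matrix, as an unnormalized integral. -/
lemma lintegral_det_pow {m n : ℕ} (hmn : m ≤ n) {a : ℝ} (ha : 0 < a) {T : ℕ} (hT : 0 < T) :
    ∫⁻ H : Fin n → Fin m → ℂ, gaussWeight (a * frobSq (Matrix.of H)) *
        ENNReal.ofReal (((Matrix.of H)ᴴ * Matrix.of H).det.re ^ T) =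
      ∏ k ∈ Finset.range m, ENNReal.ofReal (Real.Gamma ((n - k : ℕ) + T) /
        Real.Gamma (n - k : ℕ) * (a ^ T)⁻¹ * (Real.pi / a) ^ n) := by
  have hmeas : Measurable fun C : Fin m → Fin n → ℂ =>
      gaussWeight (a * frobSq (Matrix.of C)) * ENNReal.ofReal (gramDet C ^ T) :=
    (measurable_gaussWeight_frobSq m n a).mul (measurable_gramDet.pow_const T).ennreal_ofReal
  rw [← lintegral_gramDet_pow hmn ha hT, ← (measurePreserving_transpose n m).lintegral_comp hmeas]
  simp_rw [gramDet_transpose, frobSq_transpose]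

lemma ae_det_ne_zero {m n : ℕ} (hmn : m ≤ n) :
    ∀ᵐ H : Fin n → Fin m → ℂ, ((Matrix.of H)ᴴ * Matrix.of H).det.re ≠ 0 := by
  filter_upwards [(measurePreserving_transpose n m).quasiMeasurePreserving.ae
    (ae_gramDet_ne_zero hmn)] with H hH
  rwa [gramDet_transpose] at hH

/-! ### The design functional as a high-SNR limit -/

section Design

open scoped ComplexOrder

lemma det_one_add_smul {n : ℕ} {A : Matrix (Fin n) (Fin n) ℂ} (hA : A.IsHermitian) (γ : ℝ) :
    (1 + (γ : ℂ) • A).det.re = ∏ i, (1 + γ * hA.eigenvalues i) := by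
  have key : (1 + (γ : ℂ) • A).det = ((∏ i, (1 + γ * hA.eigenvalues i) : ℝ) : ℂ) := by
    by_cases hγ : γ = 0
    · simp [hγ]
    have hγ' : (γ : ℂ) ≠ 0 := Complex.ofReal_ne_zero.2 hγ
    have h1 : (1 + (γ : ℂ) • A) = (-γ : ℂ) • (Matrix.scalar (Fin n) (-(γ : ℂ)⁻¹) - A) := by
      ext i j
      by_cases hij : i = j
      · subst hij; simp; field_simp; ring
      · simp [hij]
    rw [h1, Matrix.det_smul, ← Matrix.eval_charpoly, hA.charpoly_eq, Polynomial.eval_prod,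
      Fintype.card_fin]
    have h2 : (-(γ : ℂ)) ^ n = ∏ _i : Fin n, (-(γ : ℂ)) := by simp
    rw [h2, ← Finset.prod_mul_distrib, Complex.ofReal_prod]
    refine Finset.prod_congr rfl fun i _ => ?_
    simp
    field_simp
    ring
  rw [key, Complex.ofReal_re]

lemma det_re_eq_prod {n : ℕ} {A : Matrix (Fin n) (Fin n) ℂ} (hA : A.IsHermitian) :
    A.det.re = ∏ i, hA.eigenvalues i := by
  rw [hA.det_eq_prod_eigenvalues]
  norm_cast

variable {nt T : ℕ}

/-- The rescaled term, in terms of the eigenvalues of `X X^*`. -/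
lemma pow_mul_snrTerm (ne : ℕ) {γ : ℝ} (hγ : 0 < γ) (X : Matrix (Fin nt) (Fin T) ℂ) :
    ENNReal.ofReal (γ ^ (nt * (ne + T))) * snrTerm ne γ X =
      (ENNReal.ofReal ((∏ i, (γ⁻¹ +
        (Matrix.isHermitian_mul_conjTranspose_self X).eigenvalues i)) ^ (ne + T)))⁻¹ := by
  have hev : ∀ i, 0 ≤ (Matrix.isHermitian_mul_conjTranspose_self X).eigenvalues i :=
    (Matrix.posSemidef_self_mul_conjTranspose X).eigenvalues_nonneg
  have hprod : ∏ i, (1 + γ * (Matrix.isHermitian_mul_conjTranspose_self X).eigenvalues i) =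
      γ ^ nt * ∏ i, (γ⁻¹ + (Matrix.isHermitian_mul_conjTranspose_self X).eigenvalues i) := by
    have h2 : γ ^ nt = ∏ _i : Fin nt, γ := by simp
    rw [h2, ← Finset.prod_mul_distrib]
    refine Finset.prod_congr rfl fun i _ => ?_
    field_simp
  have hpos : 0 < ∏ i, (γ⁻¹ + (Matrix.isHermitian_mul_conjTranspose_self X).eigenvalues i) :=
    Finset.prod_pos fun i _ => add_pos_of_pos_of_nonneg (inv_pos.2 hγ) (hev i)
  rw [snrTerm, det_one_add_smul (Matrix.isHermitian_mul_conjTranspose_self X), hprod,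
    ← ENNReal.ofReal_mul (by positivity), ← ENNReal.ofReal_inv_of_pos (by positivity)]
  congr 1
  rw [mul_pow, ← pow_mul, mul_inv, mul_inv_cancel_left₀ (by positivity)]

lemma pow_mul_snrTerm_le (ne : ℕ) {γ : ℝ} (hγ : 0 < γ) (X : Matrix (Fin nt) (Fin T) ℂ) :
    ENNReal.ofReal (γ ^ (nt * (ne + T))) * snrTerm ne γ X ≤
      (ENNReal.ofReal ((X * Xᴴ).det.re ^ (ne + T)))⁻¹ := by
  have hev : ∀ i, 0 ≤ (Matrix.isHermitian_mul_conjTranspose_self X).eigenvalues i :=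
    (Matrix.posSemidef_self_mul_conjTranspose X).eigenvalues_nonneg
  rw [pow_mul_snrTerm ne hγ, det_re_eq_prod (Matrix.isHermitian_mul_conjTranspose_self X)]
  refine ENNReal.inv_le_inv.2 (ENNReal.ofReal_le_ofReal ?_)
  refine pow_le_pow_left₀ (Finset.prod_nonneg fun i _ => hev i)
    (Finset.prod_le_prod (fun i _ => hev i) fun i _ => ?_) _
  linarith [inv_pos.2 hγ]

lemma tendsto_pow_mul_snrTerm (ne : ℕ) (X : Matrix (Fin nt) (Fin T) ℂ) :
    Tendsto (fun γ : ℝ => ENNReal.ofReal (γ ^ (nt * (ne + T))) * snrTerm ne γ X) atTop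
      (𝓝 (ENNReal.ofReal ((X * Xᴴ).det.re ^ (ne + T)))⁻¹) := by
  have h1 : Tendsto (fun γ : ℝ => (ENNReal.ofReal ((∏ i, (γ⁻¹ +
        (Matrix.isHermitian_mul_conjTranspose_self X).eigenvalues i)) ^ (ne + T)))⁻¹) atTop
      (𝓝 (ENNReal.ofReal ((X * Xᴴ).det.re ^ (ne + T)))⁻¹) := by
    rw [det_re_eq_prod (Matrix.isHermitian_mul_conjTranspose_self X)]
    refine (tendsto_inv_iff.2 ((ENNReal.continuous_ofReal.tendsto _).comp
      ((tendsto_finsetProd _ fun i _ => ?_).pow (ne + T))))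
    simpa using (tendsto_inv_atTop_zero (𝕜 := ℝ)).add_const
      ((Matrix.isHermitian_mul_conjTranspose_self X).eigenvalues i)
  refine h1.congr' ?_
  filter_upwards [eventually_gt_atTop 0] with γ hγ
  rw [pow_mul_snrTerm ne hγ]

/-- Series of nonnegative terms converge to the series of the limits when these bound the terms. -/
lemma tendsto_tsum_of_le {α ι : Type*} {l : Filter α} {f : α → ι → ℝ≥0∞} {g : ι → ℝ≥0∞}
    (hle : ∀ᶠ a in l, ∀ i, f a i ≤ g i) (hlim : ∀ i, Tendsto (fun a => f a i) l (𝓝 (g i))) :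
    Tendsto (fun a => ∑' i, f a i) l (𝓝 (∑' i, g i)) := by
  refine tendsto_order.2 ⟨fun b hb => ?_, fun b hb => ?_⟩
  · rw [ENNReal.tsum_eq_iSup_sum] at hb
    obtain ⟨s, hs⟩ := lt_iSup_iff.1 hb
    have h1 : Tendsto (fun a => ∑ i ∈ s, f a i) l (𝓝 (∑ i ∈ s, g i)) :=
      tendsto_finsetSum _ fun i _ => hlim i
    filter_upwards [h1.eventually (lt_mem_nhds hs)] with a ha
    exact ha.trans_le (ENNReal.sum_le_tsum s)
  · filter_upwards [hle] with a ha
    exact (ENNReal.tsum_le_tsum ha).trans_lt hb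

lemma tendsto_designSum (ne : ℕ) (Λ : AddSubgroup (Matrix (Fin nt) (Fin T) ℂ)) :
    Tendsto (fun γ : ℝ => ENNReal.ofReal (γ ^ (nt * (ne + T))) *
        ∑' X : {X : Matrix (Fin nt) (Fin T) ℂ // X ∈ Λ ∧ X ≠ 0}, snrTerm ne γ X.1)
      atTop (𝓝 (designSum ne Λ)) := by
  simp_rw [← ENNReal.tsum_mul_left]
  refine tendsto_tsum_of_le ?_ fun X => tendsto_pow_mul_snrTerm ne X.1
  filter_upwards [eventually_gt_atTop 0] with γ hγ X
  exact pow_mul_snrTerm_le ne hγ X.1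

/-- Separating the point `0` and bounding the other terms by those of the design functional. -/
lemma tsum_snrTerm_le (ne : ℕ) {γ : ℝ} (hγ : 0 < γ)
    (Λ : AddSubgroup (Matrix (Fin nt) (Fin T) ℂ)) :
    ∑' X : Λ, snrTerm ne γ (X : Matrix (Fin nt) (Fin T) ℂ) ≤
      1 + ENNReal.ofReal ((γ ^ (nt * (ne + T)))⁻¹) * designSum ne Λ := by
  classical
  have hpow : 0 < γ ^ (nt * (ne + T)) := by positivity
  have hterm : ∀ X : Matrix (Fin nt) (Fin T) ℂ, snrTerm ne γ X ≤
      ENNReal.ofReal ((γ ^ (nt * (ne + T)))⁻¹) *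
        (ENNReal.ofReal ((X * Xᴴ).det.re ^ (ne + T)))⁻¹ := by
    intro X
    refine le_trans (le_of_eq ?_) (mul_le_mul_right (pow_mul_snrTerm_le ne hγ X) _)
    rw [← mul_assoc, ← ENNReal.ofReal_mul (by positivity), inv_mul_cancel₀ hpow.ne',
      ENNReal.ofReal_one, one_mul]
  have h0 : snrTerm ne γ (0 : Matrix (Fin nt) (Fin T) ℂ) = 1 := by simp [snrTerm]
  rw [ENNReal.tsum_eq_add_tsum_ite (0 : Λ)]
  refine add_le_add (by rw [AddSubgroup.coe_zero, h0]) ?_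
  rw [designSum, ← ENNReal.tsum_mul_left]
  let e : {X : Λ // X ≠ 0} ≃ {X : Matrix (Fin nt) (Fin T) ℂ // X ∈ Λ ∧ X ≠ 0} :=
    { toFun := fun X => ⟨X.1.1, X.1.2, fun h => X.2 (Subtype.ext h)⟩
      invFun := fun X => ⟨⟨X.1, X.2.1⟩, fun h => X.2.2 (congrArg Subtype.val h)⟩
      left_inv := fun _ => rfl
      right_inv := fun _ => rfl }
  rw [← e.tsum_eq]
  have hsub := tsum_subtype {X : Λ | X ≠ 0} fun X : Λ =>
    snrTerm ne γ (X : Matrix (Fin nt) (Fin T) ℂ)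
  refine le_trans (le_of_eq (Eq.trans (tsum_congr fun X => ?_) hsub.symm))
    (ENNReal.tsum_le_tsum fun X => hterm _)
  by_cases hX : X = 0 <;> simp [hX]

end Design

/-! ### Frobenius norms and Cholesky-type factors -/

section Frobenius

open scoped ComplexOrder MatrixOrder

lemma frobSq_eq_trace {m n : ℕ} (A : Matrix (Fin m) (Fin n) ℂ) :
    ((frobSq A : ℝ) : ℂ) = (Aᴴ * A).trace := by
  simp only [frobSq, Matrix.trace, Matrix.mul_apply, Matrix.diag_apply, Matrix.conjTranspose_apply]
  rw [Finset.sum_comm]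
  push_cast
  refine Finset.sum_congr rfl fun j _ => Finset.sum_congr rfl fun i _ => ?_
  rw [← Complex.conj_mul']
  rfl

lemma frobSq_mul_eq_of_conjTranspose_mul {m n k l : ℕ} {H : Matrix (Fin m) (Fin n) ℂ}
    {B : Matrix (Fin k) (Fin n) ℂ} (h : Hᴴ * H = Bᴴ * B) (U : Matrix (Fin n) (Fin l) ℂ) :
    frobSq (H * U) = frobSq (B * U) := by
  apply Complex.ofReal_injective
  rw [frobSq_eq_trace, frobSq_eq_trace, Matrix.conjTranspose_mul, Matrix.conjTranspose_mul,
    Matrix.mul_assoc, ← Matrix.mul_assoc Hᴴ, h, Matrix.mul_assoc,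
    Matrix.mul_assoc]

lemma frobSq_add_mul {m n T : ℕ} {γ : ℝ} {X : Matrix (Fin n) (Fin T) ℂ}
    {B : Matrix (Fin n) (Fin n) ℂ} (hB : B * Bᴴ = 1 + (γ : ℂ) • (X * Xᴴ))
    (H : Matrix (Fin m) (Fin n) ℂ) :
    frobSq (H * B) = frobSq H + γ * frobSq (H * X) := by
  apply Complex.ofReal_injective
  push_cast
  rw [frobSq_eq_trace, frobSq_eq_trace, frobSq_eq_trace]
  simp only [Matrix.conjTranspose_mul]
  have h1 : (Bᴴ * Hᴴ * (H * B)).trace = (Hᴴ * H * (B * Bᴴ)).trace := by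
    rw [Matrix.mul_assoc, Matrix.trace_mul_comm]
    simp only [Matrix.mul_assoc]
  have h2 : (Xᴴ * Hᴴ * (H * X)).trace = (Hᴴ * H * (X * Xᴴ)).trace := by
    rw [Matrix.mul_assoc, Matrix.trace_mul_comm]
    simp only [Matrix.mul_assoc]
  rw [h1, h2, hB, Matrix.mul_add, Matrix.trace_add, Matrix.mul_one, Matrix.mul_smul,
    Matrix.trace_smul, smul_eq_mul]

/-- Pythagoras for the Frobenius norm. -/
lemma frobSq_mul_add {m n l : ℕ} {H : Matrix (Fin m) (Fin n) ℂ} {R : Matrix (Fin m) (Fin l) ℂ}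
    (hR : Hᴴ * R = 0) (U : Matrix (Fin n) (Fin l) ℂ) :
    frobSq (H * U + R) = frobSq (H * U) + frobSq R := by
  have hR' : Rᴴ * H = 0 := by
    have := congrArg Matrix.conjTranspose hR
    simpa using this
  apply Complex.ofReal_injective
  push_cast
  rw [frobSq_eq_trace, frobSq_eq_trace, frobSq_eq_trace, ← Matrix.trace_add]
  congr 1
  rw [Matrix.conjTranspose_add, Matrix.add_mul, Matrix.mul_add, Matrix.mul_add,
    Matrix.conjTranspose_mul, Matrix.mul_assoc Uᴴ Hᴴ R, hR, ← Matrix.mul_assoc Rᴴ, hR']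
  simp

lemma exists_conjTranspose_mul_self {n : ℕ} {A : Matrix (Fin n) (Fin n) ℂ} (hA : A.PosSemidef) :
    ∃ B : Matrix (Fin n) (Fin n) ℂ, A = Bᴴ * B :=
  CStarAlgebra.nonneg_iff_eq_star_mul_self.mp hA.nonneg

lemma det_conjTranspose_mul_self_re {ι : Type*} [Fintype ι] [DecidableEq ι] (B : Matrix ι ι ℂ) :
    (Bᴴ * B).det.re = ‖B.det‖ ^ 2 := by
  rw [Matrix.det_mul, Matrix.det_conjTranspose, ← Complex.normSq_eq_norm_sq]
  change ((starRingEnd ℂ) B.det * B.det).re = _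
  rw [← Complex.normSq_eq_conj_mul_self, Complex.ofReal_re]

lemma det_gram_mul_right {m n : ℕ} (H : Matrix (Fin m) (Fin n) ℂ) (B : Matrix (Fin n) (Fin n) ℂ) :
    ((H * B)ᴴ * (H * B)).det.re = (Hᴴ * H).det.re * ‖B.det‖ ^ 2 := by
  obtain ⟨C, hC⟩ := exists_conjTranspose_mul_self (Matrix.posSemidef_conjTranspose_mul_self H)
  have h1 : (H * B)ᴴ * (H * B) = (C * B)ᴴ * (C * B) := by
    rw [Matrix.conjTranspose_mul, Matrix.conjTranspose_mul, Matrix.mul_assoc,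
      ← Matrix.mul_assoc Hᴴ, hC, Matrix.mul_assoc, Matrix.mul_assoc]
  rw [h1, hC, det_conjTranspose_mul_self_re, det_conjTranspose_mul_self_re, Matrix.det_mul,
    norm_mul, mul_pow]

lemma det_conjTranspose_mul_self_nonneg {m n : ℕ} (H : Matrix (Fin m) (Fin n) ℂ) :
    0 ≤ (Hᴴ * H).det.re :=
  (Complex.le_def.1 (Matrix.posSemidef_conjTranspose_mul_self H).det_nonneg).1

/-- Averaging one exponential over the fading matrix: with `B B^* = 1 + γ X X^*` the substitution
`H ↦ H B` absorbs the exponential into the Gaussian weight. -/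
lemma lintegral_det_pow_mul_gaussWeight {nt ne T : ℕ} {a b : ℝ} (ha : 0 < a) (hb : 0 < b)
    (X : Matrix (Fin nt) (Fin T) ℂ) :
    ∫⁻ H : Fin ne → Fin nt → ℂ, gaussWeight (a * frobSq (Matrix.of H)) *
        (ENNReal.ofReal (((Matrix.of H)ᴴ * Matrix.of H).det.re ^ T) *
          gaussWeight (b * frobSq (Matrix.of H * X))) =
      snrTerm ne (b / a) X * ∫⁻ H : Fin ne → Fin nt → ℂ, gaussWeight (a * frobSq (Matrix.of H)) *
        ENNReal.ofReal (((Matrix.of H)ᴴ * Matrix.of H).det.re ^ T) := by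
  set γ := b / a with hγ
  have hγ0 : 0 < γ := div_pos hb ha
  have hps : (1 + (γ : ℂ) • (X * Xᴴ)).PosSemidef :=
    Matrix.PosSemidef.one.add ((Matrix.posSemidef_self_mul_conjTranspose X).smul
      (by exact_mod_cast hγ0.le))
  obtain ⟨C, hC⟩ := exists_conjTranspose_mul_self hps
  set B := Cᴴ with hBdef
  have hB : B * Bᴴ = 1 + (γ : ℂ) • (X * Xᴴ) := by
    rw [hC, hBdef, Matrix.conjTranspose_conjTranspose]
  have hdetB : (1 + (γ : ℂ) • (X * Xᴴ)).det.re = ‖B.det‖ ^ 2 := by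
    rw [hC, det_conjTranspose_mul_self_re, hBdef, Matrix.det_conjTranspose, norm_star]
  have hdpos : 0 < ‖B.det‖ ^ 2 := by
    rw [← hdetB, det_one_add_smul (Matrix.isHermitian_mul_conjTranspose_self X)]
    exact Finset.prod_pos fun i _ => by
      have := (Matrix.posSemidef_self_mul_conjTranspose X).eigenvalues_nonneg i
      positivity
  have hB0 : B.det ≠ 0 := fun h => by simp [h] at hdpos
  let L : (Fin ne → Fin nt → ℂ) →ₗ[ℂ] (Fin ne → Fin nt → ℂ) :=
    LinearMap.pi fun i => (Matrix.toLin' Bᵀ) ∘ₗ LinearMap.proj i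
  have hLdet : LinearMap.det L = B.det ^ ne := by
    rw [LinearMap.det_pi]
    simp [LinearMap.det_toLin', Matrix.det_transpose]
  have hL : ∀ H, Matrix.of (L H) = Matrix.of H * B := by
    intro H
    ext i j
    simp [L, Matrix.mulVec, dotProduct, Matrix.mul_apply, mul_comm]
  set F : (Fin ne → Fin nt → ℂ) → ℝ≥0∞ := fun H => gaussWeight (a * frobSq (Matrix.of H)) *
        ENNReal.ofReal (((Matrix.of H)ᴴ * Matrix.of H).det.re ^ T) with hF
  have hFm : Measurable F := by
    refine (measurable_gaussWeight_frobSq ne nt a).mul (Measurable.ennreal_ofReal ?_)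
    simp_rw [← gramDet_transpose]
    exact (measurable_gramDet.comp (measurePreserving_transpose ne nt).measurable).pow_const T
  have hcv := lintegral_comp_complexLinear (volume : Measure (Fin ne → Fin nt → ℂ))
    (L := L) (by rw [hLdet]; exact pow_ne_zero _ hB0) hFm
  have hFL : ∀ H, F (L H) = ENNReal.ofReal ((‖B.det‖ ^ 2) ^ T) *
      (gaussWeight (a * frobSq (Matrix.of H)) *
        (ENNReal.ofReal (((Matrix.of H)ᴴ * Matrix.of H).det.re ^ T) *
          gaussWeight (b * frobSq (Matrix.of H * X)))) := by
    intro H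
    simp only [hF, hL]
    rw [frobSq_add_mul hB, det_gram_mul_right, mul_pow, ENNReal.ofReal_mul
      (pow_nonneg (det_conjTranspose_mul_self_nonneg _) _), mul_add, gaussWeight_add,
      ← mul_assoc a, hγ, mul_div_cancel₀ _ ha.ne']
    ring
  simp_rw [hFL] at hcv
  rw [lintegral_const_mul' _ _ ENNReal.ofReal_ne_top, hLdet] at hcv
  have hTpos : 0 < (‖B.det‖ ^ 2) ^ T := pow_pos hdpos T
  have hcancel : ∀ x : ℝ≥0∞, x = ENNReal.ofReal (((‖B.det‖ ^ 2) ^ T)⁻¹) *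
      (ENNReal.ofReal ((‖B.det‖ ^ 2) ^ T) * x) := by
    intro x
    rw [← mul_assoc, ← ENNReal.ofReal_mul (by positivity), inv_mul_cancel₀ hTpos.ne',
      ENNReal.ofReal_one, one_mul]
  rw [hcancel (∫⁻ H : Fin ne → Fin nt → ℂ, gaussWeight (a * frobSq (Matrix.of H)) *
        (ENNReal.ofReal (((Matrix.of H)ᴴ * Matrix.of H).det.re ^ T) *
          gaussWeight (b * frobSq (Matrix.of H * X)))), hcv, ← mul_assoc,
    ← ENNReal.ofReal_mul (by positivity), snrTerm, hdetB]
  congr 2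
  rw [norm_pow, pow_add, mul_inv, mul_comm]
  congr 1
  rw [← pow_mul, ← pow_mul, mul_comm ne 2]

end Frobenius

/-! ### The probability of correct decoding for a given channel -/

section Channel

open scoped ComplexOrder

variable {nt ne T : ℕ}

/-- The matrix `X` with `vec X = M x`. -/
def codeword (M : Matrix (Fin T × Fin nt) (Fin T × Fin nt) ℂ) :
    (Fin T × Fin nt → ℂ) →ₗ[ℂ] Matrix (Fin nt) (Fin T) ℂ where
  toFun x := Matrix.of fun i j => (M *ᵥ x) (j, i)
  map_add' x y := by ext i j; simp [Matrix.mulVec_add]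
  map_smul' c x := by ext i j; simp [Matrix.mulVec_smul]

lemma vec_codeword (M : Matrix (Fin T × Fin nt) (Fin T × Fin nt) ℂ) (x : Fin T × Fin nt → ℂ) :
    (codeword M x).vec = M *ᵥ x := rfl

lemma codeword_inv {M : Matrix (Fin T × Fin nt) (Fin T × Fin nt) ℂ} (hM : M.det ≠ 0)
    (X : Matrix (Fin nt) (Fin T) ℂ) : codeword M (M⁻¹ *ᵥ X.vec) = X := by
  apply Matrix.vec_inj.1
  rw [vec_codeword, Matrix.mulVec_mulVec, Matrix.mul_nonsing_inv _ (isUnit_iff_ne_zero.2 hM),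
    Matrix.one_mulVec]

lemma inv_codeword {M : Matrix (Fin T × Fin nt) (Fin T × Fin nt) ℂ} (hM : M.det ≠ 0)
    (x : Fin T × Fin nt → ℂ) : M⁻¹ *ᵥ (codeword M x).vec = x := by
  rw [vec_codeword, Matrix.mulVec_mulVec, Matrix.nonsing_inv_mul _ (isUnit_iff_ne_zero.2 hM),
    Matrix.one_mulVec]

lemma mem_codeLattice_iff {M : Matrix (Fin T × Fin nt) (Fin T × Fin nt) ℂ}
    {X : Matrix (Fin nt) (Fin T) ℂ} :
    X ∈ codeLattice M ↔ ∃ w ∈ gaussIntLattice (Fin T × Fin nt), codeword M w = X := by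
  constructor
  · rintro ⟨u, hu⟩
    exact ⟨_, mem_gaussIntLattice.2 ⟨u, rfl⟩, Matrix.vec_inj.1 (by rw [vec_codeword, hu])⟩
  · rintro ⟨w, hw, rfl⟩
    obtain ⟨u, rfl⟩ := mem_gaussIntLattice.1 hw
    exact ⟨u, rfl⟩

/-- The points `H X` of the received constellation, as a function of the coordinates `x` of `X`
with respect to the generator matrix `M`. -/
noncomputable def receivedPoint (H : Matrix (Fin ne) (Fin nt) ℂ)
    (M : Matrix (Fin T × Fin nt) (Fin T × Fin nt) ℂ) :
    (Fin T × Fin nt → ℂ) →ₗ[ℂ] EuclideanSpace ℂ (Fin ne × Fin T) where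
  toFun x := WithLp.toLp 2 fun p => (H * codeword M x) p.1 p.2
  map_add' x y := by ext p; simp [Matrix.mul_add]
  map_smul' c x := by ext p; simp

lemma norm_sq_toLp_uncurry (V : Matrix (Fin ne) (Fin T) ℂ) :
    ‖(WithLp.toLp 2 fun p : Fin ne × Fin T => V p.1 p.2 :
      EuclideanSpace ℂ (Fin ne × Fin T))‖ ^ 2 = frobSq V := by
  rw [EuclideanSpace.norm_sq_eq, frobSq, Fintype.sum_prod_type]

lemma norm_receivedPoint_sq (H : Matrix (Fin ne) (Fin nt) ℂ)
    (M : Matrix (Fin T × Fin nt) (Fin T × Fin nt) ℂ) (x : Fin T × Fin nt → ℂ) :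
    ‖receivedPoint H M x‖ ^ 2 = frobSq (H * codeword M x) :=
  norm_sq_toLp_uncurry _

/-- The Gaussian integral over the coordinate space. -/
lemma lintegral_receivedPoint {H : Matrix (Fin ne) (Fin nt) ℂ}
    (hH : (Hᴴ * H).det.re ≠ 0) {M : Matrix (Fin T × Fin nt) (Fin T × Fin nt) ℂ}
    (hM : M.det ≠ 0) {c : ℝ} (hc : 0 < c) :
    ∫⁻ x, gaussWeight (c * ‖receivedPoint H M x‖ ^ 2) =
      ENNReal.ofReal ((latticeVol M * (Hᴴ * H).det.re ^ T)⁻¹ * (Real.pi / c) ^ (nt * T)) := by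
  obtain ⟨B, hB⟩ := exists_conjTranspose_mul_self (Matrix.posSemidef_conjTranspose_mul_self H)
  have hdB : (Hᴴ * H).det.re = ‖B.det‖ ^ 2 := by rw [hB, det_conjTranspose_mul_self_re]
  have hB0 : B.det ≠ 0 := fun h => hH (by rw [hdB, h]; simp)
  set N : Matrix (Fin T × Fin nt) (Fin T × Fin nt) ℂ :=
    Matrix.kroneckerMap (fun x1 x2 => x1 * x2) (1 : Matrix (Fin T) (Fin T) ℂ) B * M with hN
  have hNdet : N.det = B.det ^ T * M.det := by
    rw [hN, Matrix.det_mul, Matrix.det_kronecker]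
    simp
  have hNx : ∀ x, ‖receivedPoint H M x‖ ^ 2 = ∑ p, ‖Matrix.toLin' N x p‖ ^ 2 := by
    intro x
    rw [norm_receivedPoint_sq, frobSq_mul_eq_of_conjTranspose_mul hB, Matrix.toLin'_apply, hN,
      ← Matrix.mulVec_mulVec, ← vec_codeword M, Matrix.kronecker_mulVec_vec, Matrix.transpose_one,
      Matrix.mul_one, frobSq, Fintype.sum_prod_type, Finset.sum_comm]
    rfl
  simp_rw [hNx]
  have hdet : LinearMap.det (Matrix.toLin' N) = B.det ^ T * M.det := by
    rw [LinearMap.det_toLin', hNdet]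
  have hm : Measurable fun y : Fin T × Fin nt → ℂ => gaussWeight (c * ∑ p, ‖y p‖ ^ 2) :=
    measurable_gaussWeight.comp (by fun_prop)
  rw [lintegral_comp_complexLinear (volume : Measure (Fin T × Fin nt → ℂ))
    (L := Matrix.toLin' N) (by rw [hdet]; exact mul_ne_zero (pow_ne_zero _ hB0) hM) hm,
    lintegral_gaussWeight_pi hc, ← ENNReal.ofReal_mul (by positivity), hdet]
  have hvol : latticeVol M = ‖M.det‖ ^ 2 := by
    rw [latticeVol, Matrix.det_mul, Matrix.det_conjTranspose, norm_mul, norm_star, sq]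
  rw [hvol, hdB, Fintype.card_prod, Fintype.card_fin, Fintype.card_fin, mul_comm T nt, norm_mul,
    norm_pow]
  congr 3
  ring

lemma receivedPoint_injective {H : Matrix (Fin ne) (Fin nt) ℂ}
    (hH : (Hᴴ * H).det.re ≠ 0) {M : Matrix (Fin T × Fin nt) (Fin T × Fin nt) ℂ}
    (hM : M.det ≠ 0) : Function.Injective (receivedPoint H M) := by
  rw [injective_iff_map_eq_zero]
  intro x hx
  have hdet : (Hᴴ * H).det ≠ 0 := fun h => hH (by rw [h]; rfl)
  have h1 : H * codeword M x = 0 := by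
    ext i j
    have := congrArg (fun v : EuclideanSpace ℂ (Fin ne × Fin T) => v (i, j)) hx
    exact this
  have h2 : codeword M x = 0 := by
    have h3 : (Hᴴ * H)⁻¹ * (Hᴴ * H) * codeword M x = 0 := by
      rw [Matrix.mul_assoc, Matrix.mul_assoc, h1]; simp
    rwa [Matrix.nonsing_inv_mul _ (isUnit_iff_ne_zero.2 hdet), Matrix.one_mul] at h3
  rw [← inv_codeword hM x, h2]
  simp

/-- The coordinates of the least squares solution `(H^* H)⁻¹ H^* V`. -/
noncomputable def leastSquares (H : Matrix (Fin ne) (Fin nt) ℂ)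
    (M : Matrix (Fin T × Fin nt) (Fin T × Fin nt) ℂ) :
    (Fin ne → Fin T → ℂ) →ₗ[ℂ] (Fin T × Fin nt → ℂ) where
  toFun V := M⁻¹ *ᵥ ((Hᴴ * H)⁻¹ * (Hᴴ * Matrix.of V)).vec
  map_add' V W := by
    rw [← Matrix.mulVec_add, ← Matrix.vec_add, ← Matrix.mul_add, ← Matrix.mul_add]
    rfl
  map_smul' c V := by
    rw [RingHom.id_apply, ← Matrix.mulVec_smul, ← Matrix.vec_smul, ← Matrix.mul_smul,
      ← Matrix.mul_smul]
    rfl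

lemma codeword_leastSquares (H : Matrix (Fin ne) (Fin nt) ℂ)
    {M : Matrix (Fin T × Fin nt) (Fin T × Fin nt) ℂ} (hM : M.det ≠ 0) (V : Fin ne → Fin T → ℂ) :
    codeword M (leastSquares H M V) = (Hᴴ * H)⁻¹ * (Hᴴ * Matrix.of V) :=
  codeword_inv hM _

/-- The squared distance of `V` to a point `H X` splits off the residual of least squares. -/
lemma frobSq_sub_mul {H : Matrix (Fin ne) (Fin nt) ℂ} (hH : (Hᴴ * H).det.re ≠ 0)
    {M : Matrix (Fin T × Fin nt) (Fin T × Fin nt) ℂ} (hM : M.det ≠ 0)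
    (V : Fin ne → Fin T → ℂ) (x : Fin T × Fin nt → ℂ) :
    frobSq (Matrix.of V - H * codeword M x) =
      ‖receivedPoint H M (leastSquares H M V - x)‖ ^ 2 +
        frobSq (Matrix.of V - H * codeword M (leastSquares H M V)) := by
  have hdet : (Hᴴ * H).det ≠ 0 := fun h => hH (by rw [h]; rfl)
  have hR : Hᴴ * (Matrix.of V - H * codeword M (leastSquares H M V)) = 0 := by
    rw [codeword_leastSquares H hM, Matrix.mul_sub, ← Matrix.mul_assoc Hᴴ H,
      ← Matrix.mul_assoc (Hᴴ * H), Matrix.mul_nonsing_inv _ (isUnit_iff_ne_zero.2 hdet),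
      Matrix.one_mul, sub_self]
  rw [norm_receivedPoint_sq, ← frobSq_mul_add hR, map_sub, Matrix.mul_sub]
  congr 1
  abel

/-- Correct decoding forces the least squares coordinates of the noise
into a translate of the Voronoi cell by a point of the sublattice. -/
lemma decodesCorrectly_subset {H : Matrix (Fin ne) (Fin nt) ℂ} (hH : (Hᴴ * H).det.re ≠ 0)
    {Mb : Matrix (Fin T × Fin nt) (Fin T × Fin nt) ℂ} (hM : Mb.det ≠ 0)
    (Λe : AddSubgroup (Matrix (Fin nt) (Fin T) ℂ)) {X : Matrix (Fin nt) (Fin T) ℂ} :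
    {V : Fin ne → Fin T → ℂ | DecodesCorrectly (codeLattice Mb) Λe H (H * X + Matrix.of V) X} ⊆
      ⋃ l : Λe.comap (codeword Mb).toAddMonoidHom,
        {V | leastSquares H Mb V - l ∈ voronoiCell (receivedPoint H Mb)} := by
  rintro V ⟨Y, hY, hmin, hYX⟩
  have hl : Mb⁻¹ *ᵥ (Y - X).vec ∈ Λe.comap (codeword Mb).toAddMonoidHom := by
    change codeword Mb _ ∈ Λe
    rwa [codeword_inv hM]
  refine Set.mem_iUnion.2 ⟨⟨_, hl⟩, fun w hw => ?_⟩
  have hY' : Y + codeword Mb w ∈ codeLattice Mb :=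
    (codeLattice Mb).add_mem hY (mem_codeLattice_iff.2 ⟨w, hw, rfl⟩)
  have h1 := hmin _ hY'
  have e1 : H * X + Matrix.of V - H * Y =
      Matrix.of V - H * codeword Mb (Mb⁻¹ *ᵥ (Y - X).vec) := by
    rw [codeword_inv hM, Matrix.mul_sub]; abel
  have e2 : H * X + Matrix.of V - H * (Y + codeword Mb w) =
      Matrix.of V - H * codeword Mb (Mb⁻¹ *ᵥ (Y - X).vec + w) := by
    rw [map_add, codeword_inv hM, Matrix.mul_add, Matrix.mul_add, Matrix.mul_sub]; abel
  rw [e1, e2, frobSq_sub_mul hH hM V (_ *ᵥ _), frobSq_sub_mul hH hM V (_ + w), add_le_add_iff_right, ← sub_sub,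
    map_sub _ _ w] at h1
  exact (pow_le_pow_iff_left₀ (norm_nonneg _) (norm_nonneg _) two_ne_zero).1 h1

/-- The probability that the least squares coordinates of the noise lie in one of the translates of
the Voronoi cell. -/
lemma tsum_gaussianMatrix_voronoiCell_le {σ c : ℝ} (hσ : 0 < σ) (hc : c = (2 * σ ^ 2)⁻¹)
    {H : Matrix (Fin ne) (Fin nt) ℂ} (hH : (Hᴴ * H).det.re ≠ 0)
    {M : Matrix (Fin T × Fin nt) (Fin T × Fin nt) ℂ} (hM : M.det ≠ 0)
    {Λ : AddSubgroup (Fin T × Fin nt → ℂ)} (hΛ : Λ ≤ gaussIntLattice _) :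
    ∑' l : Λ, gaussianMatrix ne T σ
        {V | leastSquares H M V - l ∈ voronoiCell (receivedPoint H M)} ≤
      ENNReal.ofReal (latticeVol M * (Hᴴ * H).det.re ^ T * (c / Real.pi) ^ (nt * T)) *
        ∑' l : Λ, gaussWeight (c * ‖receivedPoint H M l‖ ^ 2) := by
  have hc0 : 0 < c := by rw [hc]; positivity
  have hvol : 0 < latticeVol M := by
    rw [latticeVol, Matrix.det_mul, Matrix.det_conjTranspose, norm_mul, norm_star]
    have := norm_pos_iff.2 hM
    positivity
  have hdet0 : 0 < (Hᴴ * H).det.re :=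
    lt_of_le_of_ne (det_conjTranspose_mul_self_nonneg H) hH.symm
  have hZF := lintegral_receivedPoint hH hM hc0
  set ZF := ∫⁻ x, gaussWeight (c * ‖receivedPoint H M x‖ ^ 2) with hZFdef
  have hZF0 : ZF ≠ 0 := by
    rw [hZF, ne_eq, ENNReal.ofReal_eq_zero, not_le]
    positivity
  have hZFt : ZF ≠ ∞ := by rw [hZF]; exact ENNReal.ofReal_ne_top
  have hinj := receivedPoint_injective hH hM
  -- the fibre decomposition of the noise along least squares
  let A : (Fin T × Fin nt → ℂ) →ₗ[ℝ] (Fin ne → Fin T → ℂ) :=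
    { toFun := fun x i j => (H * codeword M x) i j
      map_add' := fun x y => by
        funext i j
        simp [Matrix.mul_add]
      map_smul' := fun r x => by
        have e : codeword M (r • x) = (r : ℂ) • codeword M x := by
          rw [← map_smul]; rfl
        funext i j
        simp [e] }
  have hA : ∀ x, Matrix.of (A x) = H * codeword M x := fun x => rfl
  let q : (Fin ne → Fin T → ℂ) → ℝ := fun V => c * frobSq (Matrix.of V)
  have hqc : Continuous q := by
    simp only [q, frobSq, Matrix.of_apply]
    fun_prop
  have hπA : ∀ x, leastSquares H M (A x) = x := by
    intro x
    have hdet : (Hᴴ * H).det ≠ 0 := fun h => hH (by rw [h]; rfl)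
    change M⁻¹ *ᵥ ((Hᴴ * H)⁻¹ * (Hᴴ * (H * codeword M x))).vec = x
    rw [← Matrix.mul_assoc Hᴴ, ← Matrix.mul_assoc, Matrix.nonsing_inv_mul _
      (isUnit_iff_ne_zero.2 hdet), Matrix.one_mul, inv_codeword hM]
  have hq : ∀ V, q V = q (A (leastSquares H M V)) + q (V - A (leastSquares H M V)) := by
    intro V
    have h1 := frobSq_sub_mul hH hM V 0
    rw [map_zero, Matrix.mul_zero, sub_zero, sub_zero, norm_receivedPoint_sq] at h1
    simp only [q]
    rw [← mul_add, h1]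
    rfl
  have hqA : ∀ x, q (A x) = c * ‖receivedPoint H M x‖ ^ 2 := fun x => by
    rw [norm_receivedPoint_sq]; rfl
  have hZE := lintegral_gaussWeight_frobSq ne T hc0
  obtain ⟨k, hk⟩ := exists_lintegral_gaussWeight_comp_proj
    (volume : Measure (Fin ne → Fin T → ℂ)) (volume : Measure (Fin T × Fin nt → ℂ)) A
    ((leastSquares H M).restrictScalars ℝ) hπA hqc hq (by
      simp only [q]; rw [hZE]; exact ENNReal.ofReal_ne_top)
  simp only [hqA] at hk
  have hk1 := hk (fun _ => 1) measurable_const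
  simp only [mul_one, q] at hk1
  rw [hZE, ← hZFdef] at hk1
  -- the normalizations of the noise and of its projection
  have hnorm : ENNReal.ofReal ((c / Real.pi) ^ (ne * T)) * k = ZF⁻¹ := by
    refine ENNReal.eq_inv_of_mul_eq_one_left ?_
    rw [mul_assoc, ← hk1, ← ENNReal.ofReal_mul (by positivity), ← mul_pow]
    field_simp
    simp
  have hterm : ∀ l : Λ, gaussianMatrix ne T σ
        {V | leastSquares H M V - l ∈ voronoiCell (receivedPoint H M)} =
      ZF⁻¹ * ∫⁻ x, gaussWeight (c * ‖receivedPoint H M x‖ ^ 2) *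
        (voronoiCell (receivedPoint H M)).indicator (fun _ => 1) (x - l) := by
    intro l
    have hgm : Measurable fun x : Fin T × Fin nt → ℂ =>
        (voronoiCell (receivedPoint H M)).indicator (fun _ => (1 : ℝ≥0∞)) (x - l) :=
      (measurable_const.indicator (measurableSet_voronoiCell _)).comp (measurable_sub_const _)
    have hset : MeasurableSet
        {V : Fin ne → Fin T → ℂ | leastSquares H M V - l ∈ voronoiCell (receivedPoint H M)} :=
      ((leastSquares H M).continuous_of_finiteDimensional.measurable.sub_const _)
        (measurableSet_voronoiCell _)
    rw [← lintegral_indicator_one hset, lintegral_gaussianMatrix ne T hσ hc, ← hnorm, mul_assoc,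
      ← hk _ hgm]
    rfl
  simp_rw [hterm]
  rw [ENNReal.tsum_mul_left]
  refine mul_le_mul' (le_of_eq ?_) (tsum_lintegral_voronoiCell_le hinj hc0 ?_ hΛ)
  · rw [hZF, ← ENNReal.ofReal_inv_of_pos (by positivity)]
    congr 1
    rw [mul_inv, inv_inv, ← inv_pow, inv_div]
  · rw [lintegral_receivedPoint hH hM (by positivity)]
    exact ENNReal.ofReal_ne_top

/-- The bound on the probability of correct decoding for a channel of full column rank. -/
lemma correctProbGiven_le {σ c : ℝ} (hσ : 0 < σ) (hc : c = (2 * σ ^ 2)⁻¹)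
    {H : Matrix (Fin ne) (Fin nt) ℂ} (hH : (Hᴴ * H).det.re ≠ 0)
    {Mb : Matrix (Fin T × Fin nt) (Fin T × Fin nt) ℂ} (hM : Mb.det ≠ 0)
    {Λe : AddSubgroup (Matrix (Fin nt) (Fin T) ℂ)} (hsub : Λe ≤ codeLattice Mb)
    (law : PMF (codeLattice Mb)) :
    correctProbGiven σ (codeLattice Mb) Λe law H ≤
      ENNReal.ofReal (latticeVol Mb * (Hᴴ * H).det.re ^ T * (c / Real.pi) ^ (nt * T)) *
        ∑' X : Λe, gaussWeight (c * frobSq (H * (X : Matrix (Fin nt) (Fin T) ℂ))) := by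
  set Λ := Λe.comap (codeword Mb).toAddMonoidHom with hΛdef
  have hmem : ∀ x, x ∈ Λ ↔ codeword Mb x ∈ Λe := fun x => Iff.rfl
  have hΛ : Λ ≤ gaussIntLattice _ := by
    intro x hx
    obtain ⟨w, hw, hwx⟩ := mem_codeLattice_iff.1 (hsub ((hmem x).1 hx))
    rw [← inv_codeword hM x, ← hwx, inv_codeword hM]
    exact hw
  have hcount : Countable Λ := (AddSubgroup.inclusion_injective hΛ).countable
  let e : Λ ≃ Λe :=
    { toFun := fun x => ⟨codeword Mb x, x.2⟩
      invFun := fun X => ⟨Mb⁻¹ *ᵥ (X : Matrix (Fin nt) (Fin T) ℂ).vec, by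
        rw [hmem, codeword_inv hM]; exact X.2⟩
      left_inv := fun x => Subtype.ext (inv_codeword hM _)
      right_inv := fun X => Subtype.ext (codeword_inv hM _) }
  have hbound : ∀ X : codeLattice Mb, gaussianMatrix ne T σ {V | DecodesCorrectly (codeLattice Mb)
        Λe H (H * (X : Matrix (Fin nt) (Fin T) ℂ) + Matrix.of V) X} ≤
      ENNReal.ofReal (latticeVol Mb * (Hᴴ * H).det.re ^ T * (c / Real.pi) ^ (nt * T)) *
        ∑' X : Λe, gaussWeight (c * frobSq (H * (X : Matrix (Fin nt) (Fin T) ℂ))) := by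
    intro X
    refine (measure_mono (decodesCorrectly_subset hH hM Λe)).trans ?_
    refine (measure_iUnion_le _).trans ?_
    refine (tsum_gaussianMatrix_voronoiCell_le hσ hc hH hM hΛ).trans (le_of_eq ?_)
    congr 1
    rw [← e.tsum_eq]
    refine tsum_congr fun l => ?_
    rw [norm_receivedPoint_sq]
    rfl
  rw [correctProbGiven]
  refine (ENNReal.tsum_le_tsum fun X => mul_le_mul_right (hbound X) _).trans ?_
  rw [ENNReal.tsum_mul_right, law.tsum_coe, one_mul]

end Channel

/-! ### Averaging over the fading matrix -/

section Average

variable {nt ne T : ℕ}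

lemma multiGamma_div {p : ℕ} (a b : ℝ) :
    multiGamma p a / multiGamma p b =
      ∏ k ∈ Finset.range p, Real.Gamma (a - k) / Real.Gamma (b - k) := by
  have h : ∀ x : ℝ, ∏ k ∈ Finset.Icc 1 p, Real.Gamma (x - k + 1) =
      ∏ k ∈ Finset.range p, Real.Gamma (x - k) := by
    intro x
    rw [← Finset.Ico_succ_right_eq_Icc, Finset.prod_Ico_eq_prod_range]
    refine Finset.prod_congr rfl fun k _ => ?_
    push_cast
    congr 1
    ring
  rw [multiGamma, multiGamma, h, h, mul_div_mul_left _ _ (pow_ne_zero _ Real.pi_ne_zero),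
    Finset.prod_div_distrib]

/-- All the constants of the averaged bound combine to `C_MIMO γ^(T nt)`. -/
lemma average_constant (hne : nt ≤ ne) {a b : ℝ} (ha : 0 < a) (hb : 0 < b)
    (M : Matrix (Fin T × Fin nt) (Fin T × Fin nt) ℂ) :
    ENNReal.ofReal ((a / Real.pi) ^ (ne * nt)) *
        (ENNReal.ofReal (latticeVol M * (b / Real.pi) ^ (nt * T)) *
          ∏ k ∈ Finset.range nt, ENNReal.ofReal (Real.Gamma ((ne - k : ℕ) + T) /
            Real.Gamma (ne - k : ℕ) * (a ^ T)⁻¹ * (Real.pi / a) ^ ne)) =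
      ENNReal.ofReal (cMIMO ne M * (b / a) ^ (T * nt)) := by
  have hvol : 0 ≤ latticeVol M := norm_nonneg _
  have hfac : ∀ k ∈ Finset.range nt, 0 ≤ Real.Gamma ((ne - k : ℕ) + T) /
            Real.Gamma (ne - k : ℕ) * (a ^ T)⁻¹ * (Real.pi / a) ^ ne := by
    intro k hk
    have h1 : 0 ≤ Real.Gamma (ne - k : ℕ) := Real.Gamma_nonneg_of_nonneg (Nat.cast_nonneg _)
    have h2 : 0 ≤ Real.Gamma ((ne - k : ℕ) + T) := Real.Gamma_nonneg_of_nonneg (by positivity)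
    positivity
  rw [← ENNReal.ofReal_prod_of_nonneg hfac, ← ENNReal.ofReal_mul (by positivity),
    ← ENNReal.ofReal_mul (by positivity)]
  congr 1
  have hΓ : multiGamma nt (ne + T) / multiGamma nt ne = ∏ k ∈ Finset.range nt,
      Real.Gamma ((ne - k : ℕ) + T) / Real.Gamma (ne - k : ℕ) := by
    rw [multiGamma_div]
    refine Finset.prod_congr rfl fun k hk => ?_
    rw [Nat.cast_sub ((Finset.mem_range.1 hk).le.trans hne)]
    congr 2
    ring
  have hc : cMIMO ne M = latticeVol M / Real.pi ^ (nt * T) *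
      (multiGamma nt (ne + T) / multiGamma nt ne) := by
    rw [cMIMO, mul_div_mul_comm]
  rw [hc, hΓ, Finset.prod_mul_distrib, Finset.prod_mul_distrib, Finset.prod_const,
    Finset.prod_const, Finset.card_range, ← pow_mul, inv_pow, ← pow_mul]
  have hpi := Real.pi_pos
  simp only [div_pow]
  rw [mul_comm T nt]
  field_simp

/-- The average of the conditional bounds. -/
lemma avgCorrectProb_le (hT : 0 < T) (hne : nt ≤ ne) {σH σe : ℝ} (hσH : 0 < σH) (hσe : 0 < σe)
    {Mb : Matrix (Fin T × Fin nt) (Fin T × Fin nt) ℂ} (hM : Mb.det ≠ 0)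
    {Λe : AddSubgroup (Matrix (Fin nt) (Fin T) ℂ)} (hsub : Λe ≤ codeLattice Mb)
    (law : PMF (codeLattice Mb)) :
    avgCorrectProb ne σH σe (codeLattice Mb) Λe law ≤
      ENNReal.ofReal (cMIMO ne Mb * (σH ^ 2 / σe ^ 2) ^ (T * nt)) *
        ∑' X : Λe, snrTerm ne (σH ^ 2 / σe ^ 2) (X : Matrix (Fin nt) (Fin T) ℂ) := by
  obtain ⟨a, ha⟩ : ∃ a : ℝ, a = (2 * σH ^ 2)⁻¹ := ⟨_, rfl⟩
  obtain ⟨b, hb⟩ : ∃ b : ℝ, b = (2 * σe ^ 2)⁻¹ := ⟨_, rfl⟩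
  have ha0 : 0 < a := by rw [ha]; positivity
  have hb0 : 0 < b := by rw [hb]; positivity
  have hγ : σH ^ 2 / σe ^ 2 = b / a := by
    rw [ha, hb]
    field_simp
  have hcount : Countable Λe := by
    have : Countable (codeLattice Mb) := by
      have hr : (codeLattice Mb : Set (Matrix (Fin nt) (Fin T) ℂ)) ⊆
          Set.range fun w : gaussIntLattice (Fin T × Fin nt) => codeword Mb w := by
        intro X hX
        obtain ⟨w, hw, hwX⟩ := mem_codeLattice_iff.1 hX
        exact ⟨⟨w, hw⟩, hwX⟩
      exact ((Set.countable_range _).mono hr).to_subtype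
    exact (AddSubgroup.inclusion_injective hsub).countable
  have hvol : 0 ≤ latticeVol Mb := norm_nonneg _
  set K := ENNReal.ofReal (latticeVol Mb * (b / Real.pi) ^ (nt * T)) with hK
  have hmeas : ∀ X : Λe, Measurable fun H : Fin ne → Fin nt → ℂ =>
      gaussWeight (a * frobSq (Matrix.of H)) *
        (ENNReal.ofReal (((Matrix.of H)ᴴ * Matrix.of H).det.re ^ T) *
          gaussWeight (b * frobSq (Matrix.of H * (X : Matrix (Fin nt) (Fin T) ℂ)))) := by
    intro X
    have h1 : Measurable fun H : Fin ne → Fin nt → ℂ =>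
        ENNReal.ofReal (((Matrix.of H)ᴴ * Matrix.of H).det.re ^ T) := by
      simp_rw [← gramDet_transpose]
      exact ((measurable_gramDet.comp
        (measurePreserving_transpose ne nt).measurable).pow_const T).ennreal_ofReal
    have h2 : Measurable fun H : Fin ne → Fin nt → ℂ =>
        gaussWeight (b * frobSq (Matrix.of H * (X : Matrix (Fin nt) (Fin T) ℂ))) := by
      refine measurable_gaussWeight.comp (Continuous.measurable ?_)
      simp only [frobSq, Matrix.mul_apply, Matrix.of_apply]
      fun_prop
    exact (measurable_gaussWeight_frobSq ne nt a).mul (h1.mul h2)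
  rw [avgCorrectProb, lintegral_gaussianMatrix ne nt hσH ha, hγ,
    ← average_constant hne ha0 hb0 Mb, mul_assoc]
  refine mul_le_mul_right ?_ _
  calc ∫⁻ H : Fin ne → Fin nt → ℂ, gaussWeight (a * frobSq (Matrix.of H)) *
          correctProbGiven σe (codeLattice Mb) Λe law (Matrix.of H)
      ≤ ∫⁻ H : Fin ne → Fin nt → ℂ, K * ∑' X : Λe, gaussWeight (a * frobSq (Matrix.of H)) *
          (ENNReal.ofReal (((Matrix.of H)ᴴ * Matrix.of H).det.re ^ T) *
            gaussWeight (b * frobSq (Matrix.of H * (X : Matrix (Fin nt) (Fin T) ℂ)))) := by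
        refine lintegral_mono_ae ?_
        filter_upwards [ae_det_ne_zero hne] with H hH
        refine (mul_le_mul_right (correctProbGiven_le hσe hb hH hM hsub law) _).trans
          (le_of_eq ?_)
        have hd : 0 ≤ ((Matrix.of H)ᴴ * Matrix.of H).det.re ^ T :=
          pow_nonneg (det_conjTranspose_mul_self_nonneg _) _
        rw [ENNReal.tsum_mul_left, ENNReal.tsum_mul_left, hK,
          mul_right_comm (latticeVol Mb), ENNReal.ofReal_mul (by positivity)]
        ring
    _ = K * ∑' X : Λe, ∫⁻ H : Fin ne → Fin nt → ℂ, gaussWeight (a * frobSq (Matrix.of H)) *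
          (ENNReal.ofReal (((Matrix.of H)ᴴ * Matrix.of H).det.re ^ T) *
            gaussWeight (b * frobSq (Matrix.of H * (X : Matrix (Fin nt) (Fin T) ℂ)))) := by
        rw [lintegral_const_mul' _ _ ENNReal.ofReal_ne_top,
          lintegral_tsum fun X => (hmeas X).aemeasurable]
    _ = _ := by
        simp_rw [lintegral_det_pow_mul_gaussWeight ha0 hb0]
        rw [ENNReal.tsum_mul_right, lintegral_det_pow hne ha0 hT]
        ring

end Average

end MIMOWiretap

theorem mainTheorem1 (nt ne T : ℕ) (hnt : 0 < nt) (hT : 0 < T) (hne : nt ≤ ne)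
    (σH σe : ℝ) (hσH : 0 < σH) (hσe : 0 < σe)
    (Mb Me : Matrix (Fin T × Fin nt) (Fin T × Fin nt) ℂ)
    (hMb : Mb.det ≠ 0) (hMe : Me.det ≠ 0)
    (hsub : MIMOWiretap.codeLattice Me ≤ MIMOWiretap.codeLattice Mb)
    (law : PMF (MIMOWiretap.codeLattice Mb))
    (γe : ℝ) (hγe : γe = σH ^ 2 / σe ^ 2) :
    -- the bound on Eve's average probability of correct decoding
    MIMOWiretap.avgCorrectProb ne σH σe
        (MIMOWiretap.codeLattice Mb) (MIMOWiretap.codeLattice Me) law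
      ≤ ENNReal.ofReal (MIMOWiretap.cMIMO ne Mb * γe ^ (T * nt)) *
          ∑' X : MIMOWiretap.codeLattice Me,
            MIMOWiretap.snrTerm ne γe (X : Matrix (Fin nt) (Fin T) ℂ)
    -- the resulting bound through the design functional
    ∧ MIMOWiretap.avgCorrectProb ne σH σe
        (MIMOWiretap.codeLattice Mb) (MIMOWiretap.codeLattice Me) law
      ≤ ENNReal.ofReal (MIMOWiretap.cMIMO ne Mb) *
          (ENNReal.ofReal (γe ^ (T * nt)) +
            ENNReal.ofReal ((γe ^ (ne * nt))⁻¹) *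
              MIMOWiretap.designSum ne (MIMOWiretap.codeLattice Me))
    -- the design functional is the high-SNR limit of the normalized nonzero part of the sum
    ∧ Tendsto
        (fun γ : ℝ => ENNReal.ofReal (γ ^ (nt * (ne + T))) *
          ∑' X : {X : Matrix (Fin nt) (Fin T) ℂ //
              X ∈ MIMOWiretap.codeLattice Me ∧ X ≠ 0},
            MIMOWiretap.snrTerm ne γ X.1)
        atTop (𝓝 (MIMOWiretap.designSum ne (MIMOWiretap.codeLattice Me))) := by
  have hγ0 : 0 < γe := by rw [hγe]; positivity
  have h1 := MIMOWiretap.avgCorrectProb_le hT hne hσH hσe hMb hsub law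
  rw [← hγe] at h1
  refine ⟨h1, ?_, MIMOWiretap.tendsto_designSum ne _⟩
  have hpow : γe ^ (T * nt) * (γe ^ (nt * (ne + T)))⁻¹ = (γe ^ (ne * nt))⁻¹ := by
    rw [show nt * (ne + T) = T * nt + ne * nt by ring, pow_add, mul_inv,
      mul_inv_cancel_left₀ (by positivity)]
  refine (h1.trans (mul_le_mul_right (MIMOWiretap.tsum_snrTerm_le ne hγ0 _) _)).trans
    (le_of_eq ?_)
  rw [ENNReal.ofReal_mul' (by positivity), mul_assoc, mul_add, mul_one, ← mul_assoc
    (ENNReal.ofReal (γe ^ (T * nt))), ← ENNReal.ofReal_mul (by positivity), hpow]
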